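/- Let $D\subset\mathbb{R}^2$ be a bounded domain with smooth boundary $\partial D$, with unit normal $\nu=(\nu_1,\nu_2)$ (pointing out of $D$) and unit tangent $\tau=(-\nu_2,\nu_1)$ on $\partial D$. Let $T>0$, let $\tilde R>0$ be such that $\overline D\subset B_{\tilde R}=\{x:|x|<\tilde R\}$, and put $\Omega=B_{\tilde R}\setminus\overline D$. Let $\lambda,\mu\in\mathbb{R}$ satisfy $\mu>0$, $\lambda+\mu>0$, and set $c_1=(\lambda+2\mu)^{1/2}$, $c_2=\mu^{1/2}$. For given functions $f_1,f_2$ on $\partial D\times(0,T)$, consider the coupled initial-boundary value problem $$\begin{cases}\Delta\phi-\frac1{c_1^2}\partial_t^2\phi=0,\quad \Delta\psi-\frac1{c_2^2}\partial_t^2\psi=0&\text{in }\Omega\times(0,T],\\ \partial_\nu\phi+\partial_\tau\psi=f_1,\quad \partial_\tau\phi-\partial_\nu\psi=f_2&\text{on }\partial D\times(0,T),\\ \phi=0,\quad\psi=0&\text{on }\partial B_{\tilde R}\times(0,T),\\ \phi|_{t=0}=\partial_t\phi|_{t=0}=0,\quad \psi|_{t=0}=\partial_t\psi|_{t=0}=0&\text{in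 }\Omega.\end{cases}$$ Here, for $\phi,\psi\in L^2(0,T;H^2(\Omega))$, the time derivatives are weak derivatives in $L^2(0,T;L^2(\Omega))$, the wave equations hold in $L^2(\Omega)$ for almost every $t$, the initial values are those of the representatives of $\phi,\partial_t\phi,\psi,\partial_t\psi$ that are continuous on $[0,T]$ with values in $L^2(\Omega)$, and the boundary conditions hold for almost every $t$ in the sense of traces of $H^1(\Omega)$-functions. Then the problem has at most one solution $(\phi,\psi)$ with $\phi\in L^2(0,T;H^2(\Omega))$ and $\psi\in L^2(0,T;H^2(\Omega))$. -/

import Mathlib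

open MeasureTheory Filter Topology Set
open scoped ContDiff ENNReal

noncomputable section

/-- The Euclidean plane. -/
abbrev Plane : Type := EuclideanSpace ℝ (Fin 2)

/-! ### Planar domains with smooth boundary -/

/-- In the ball of radius `r` about `x`, and in the orthonormal coordinates given by `L`,
the set `D` is the part of the plane above the graph of the smooth function `γ`. -/
def IsBoundaryChart (D : Set Plane) (x : Plane) (L : Plane ≃ₗᵢ[ℝ] Plane) (γ : ℝ → ℝ)
    (r : ℝ) : Prop :=
  0 < r ∧ ContDiff ℝ ∞ γ ∧ ∀ y ∈ Metric.ball x r, y ∈ D ↔ γ (L y 0) < L y 1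

/-- The boundary of `D` is smooth: near each of its points, `D` is one side of a smooth graph. -/
def HasSmoothBoundary (D : Set Plane) : Prop :=
  ∀ x ∈ frontier D, ∃ L γ r, IsBoundaryChart D x L γ r

/-- `n` is the unit normal vector of the boundary of `D` at `x` that points out of `D`. -/
def IsOuterUnitNormal (D : Set Plane) (x n : Plane) : Prop :=
  ∃ L γ r, IsBoundaryChart D x L γ r ∧
    L n = (Real.sqrt (1 + deriv γ (L x 0) ^ 2))⁻¹ • !₂[deriv γ (L x 0), -1]

/-- The outer unit normal field `ν` on the boundary of `D`. -/
def outerNormal (D : Set Plane) (x : Plane) : Plane :=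
  Classical.epsilon (IsOuterUnitNormal D x)

/-- The unit tangential field `τ = (-ν₂, ν₁)` on the boundary of `D`. -/
def tangent (D : Set Plane) (x : Plane) : Plane :=
  !₂[-(outerNormal D x 1), outerNormal D x 0]

/-! ### Sobolev spaces -/

/-- The space `L²(Ω)`. -/
abbrev L2 (Ω : Set Plane) : Type := Lp ℝ 2 (volume.restrict Ω)

/-- Test functions: smooth with compact support contained in `Ω`. -/
def IsTestFun {E : Type*} [NormedAddCommGroup E] [NormedSpace ℝ E] (Ω : Set E) (η : E → ℝ) :
    Prop :=
  ContDiff ℝ ∞ η ∧ HasCompactSupport η ∧ tsupport η ⊆ Ω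

/-- The classical partial derivative in the `i`-th coordinate direction. -/
def pderiv (i : Fin 2) (η : Plane → ℝ) (x : Plane) : ℝ :=
  fderiv ℝ η x (EuclideanSpace.single i 1)

/-- `g` is the weak `i`-th partial derivative of `u` in `Ω`. -/
def IsWeakPartial (Ω : Set Plane) (i : Fin 2) (u g : L2 Ω) : Prop :=
  ∀ η : Plane → ℝ, IsTestFun Ω η →
    ∫ x in Ω, u x * pderiv i η x = -∫ x in Ω, g x * η x

theorem IsTestFun.memLp {Ω : Set Plane} {η : Plane → ℝ} (h : IsTestFun Ω η) :
    MemLp η 2 (volume.restrict Ω) :=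
  (h.1.continuous.memLp_of_hasCompactSupport h.2.1).restrict _

theorem IsTestFun.memLp_pderiv {Ω : Set Plane} {η : Plane → ℝ} (h : IsTestFun Ω η) (i : Fin 2) :
    MemLp (pderiv i η) 2 (volume.restrict Ω) := by
  have hc : Continuous (pderiv i η) := (h.1.continuous_fderiv (by simp)).clm_apply continuous_const
  have hs : HasCompactSupport (pderiv i η) := h.2.1.fderiv_apply ℝ _
  exact (hc.memLp_of_hasCompactSupport hs).restrict _

theorem integral_add_mul_aux {Ω : Set Plane} (u v : L2 Ω) {f : Plane → ℝ}
    (hf : MemLp f 2 (volume.restrict Ω)) :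
    ∫ x in Ω, (u + v : L2 Ω) x * f x = (∫ x in Ω, u x * f x) + ∫ x in Ω, v x * f x := by
  have h₁ : Integrable (fun x => u x * f x) (volume.restrict Ω) := (Lp.memLp u).integrable_mul hf
  have h₂ : Integrable (fun x => v x * f x) (volume.restrict Ω) := (Lp.memLp v).integrable_mul hf
  rw [← integral_add h₁ h₂]
  refine integral_congr_ae ?_
  filter_upwards [Lp.coeFn_add u v] with x hx
  rw [hx, Pi.add_apply, add_mul]

theorem integral_smul_mul_aux {Ω : Set Plane} (a : ℝ) (u : L2 Ω) (f : Plane → ℝ) :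
    ∫ x in Ω, (a • u : L2 Ω) x * f x = a * ∫ x in Ω, u x * f x := by
  rw [← integral_const_mul]
  refine integral_congr_ae ?_
  filter_upwards [Lp.coeFn_smul a u] with x hx
  rw [hx, Pi.smul_apply, smul_eq_mul, mul_assoc]

theorem integral_zero_mul_aux {Ω : Set Plane} (f : Plane → ℝ) :
    ∫ x in Ω, (0 : L2 Ω) x * f x = 0 := by
  simpa using integral_smul_mul_aux 0 (0 : L2 Ω) f

theorem IsWeakPartial.zero {Ω : Set Plane} {i : Fin 2} :
    IsWeakPartial Ω i (0 : L2 Ω) 0 := by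
  intro η _
  rw [integral_zero_mul_aux, integral_zero_mul_aux, neg_zero]

theorem IsWeakPartial.add {Ω : Set Plane} {i : Fin 2} {u v g h : L2 Ω}
    (hu : IsWeakPartial Ω i u g) (hv : IsWeakPartial Ω i v h) :
    IsWeakPartial Ω i (u + v) (g + h) := by
  intro η hη
  rw [integral_add_mul_aux u v (hη.memLp_pderiv i), integral_add_mul_aux g h hη.memLp,
    hu η hη, hv η hη]
  ring

theorem IsWeakPartial.smul {Ω : Set Plane} {i : Fin 2} (a : ℝ) {u g : L2 Ω}
    (hu : IsWeakPartial Ω i u g) : IsWeakPartial Ω i (a • u) (a • g) := by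
  intro η hη
  rw [integral_smul_mul_aux, integral_smul_mul_aux, hu η hη]
  ring

/-- The Sobolev space `H¹(Ω)`: a function together with its weak gradient, all in `L²(Ω)`, with
the Hilbert space norm `(‖u‖² + ∑ i, ‖∂ᵢu‖²)^(1/2)`. -/
def H1 (Ω : Set Plane) : Submodule ℝ (PiLp 2 (fun _ : Unit ⊕ Fin 2 => L2 Ω)) where
  carrier := {u | ∀ i, IsWeakPartial Ω i (u (.inl ())) (u (.inr i))}
  zero_mem' := fun _ => IsWeakPartial.zero
  add_mem' := fun hu hv i => (hu i).add (hv i)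
  smul_mem' := fun a _ hu i => (hu i).smul a

/-- The Sobolev space `H²(Ω)`: a function together with its weak first and second derivatives,
all in `L²(Ω)`, with the Hilbert space norm
`(‖u‖² + ∑ i, ‖∂ᵢu‖² + ∑ i j, ‖∂ⱼ∂ᵢu‖²)^(1/2)`. -/
def H2 (Ω : Set Plane) :
    Submodule ℝ (PiLp 2 (fun _ : Unit ⊕ Fin 2 ⊕ (Fin 2 × Fin 2) => L2 Ω)) where
  carrier := {u | (∀ i, IsWeakPartial Ω i (u (.inl ())) (u (.inr (.inl i)))) ∧
    ∀ i j, IsWeakPartial Ω j (u (.inr (.inl i))) (u (.inr (.inr (i, j))))}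
  zero_mem' := ⟨fun _ => IsWeakPartial.zero, fun _ _ => IsWeakPartial.zero⟩
  add_mem' := fun hu hv => ⟨fun i => (hu.1 i).add (hv.1 i), fun i j => (hu.2 i j).add (hv.2 i j)⟩
  smul_mem' := fun a _ hu => ⟨fun i => (hu.1 i).smul a, fun i j => (hu.2 i j).smul a⟩

/-- The function in `L²(Ω)` underlying an element of `H¹(Ω)`. -/
def H1.toL2 {Ω : Set Plane} (u : H1 Ω) : L2 Ω := u.1 (.inl ())

/-- The weak partial derivatives of an element of `H¹(Ω)`. -/
def H1.partial {Ω : Set Plane} (u : H1 Ω) (i : Fin 2) : L2 Ω := u.1 (.inr i)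

/-- The function in `L²(Ω)` underlying an element of `H²(Ω)`. -/
def H2.toL2 {Ω : Set Plane} (u : H2 Ω) : L2 Ω := u.1 (.inl ())

/-- The inclusion of `H²(Ω)` in `H¹(Ω)`. -/
def H2.toH1 {Ω : Set Plane} (u : H2 Ω) : H1 Ω :=
  ⟨WithLp.toLp 2 (Sum.elim (fun _ => u.1 (.inl ())) (fun i => u.1 (.inr (.inl i)))),
    fun i => u.2.1 i⟩

/-- The weak partial derivatives of an element of `H²(Ω)`, as elements of `H¹(Ω)`. -/
def H2.partial {Ω : Set Plane} (u : H2 Ω) (i : Fin 2) : H1 Ω :=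
  ⟨WithLp.toLp 2 (Sum.elim (fun _ => u.1 (.inr (.inl i))) (fun j => u.1 (.inr (.inr (i, j))))),
    fun j => u.2.2 i j⟩

/-- The weak Laplacian of an element of `H²(Ω)`. -/
def H2.laplacian {Ω : Set Plane} (u : H2 Ω) : L2 Ω := ∑ i, H1.partial (H2.partial u i) i

/-! ### Boundary traces -/

/-- The one-dimensional Hausdorff (arc length) measure on a set `Γ`. -/
def arcLength (Γ : Set Plane) : Measure Plane := (μH[1] : Measure Plane).restrict Γ

/-- `g ∈ L²(Γ)` is the trace of `w ∈ H¹(Ω)` on the part `Γ` of the boundary of `Ω`: it is the limit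
in `L²(Γ)` of the restrictions to `Γ` of functions smooth up to the boundary that converge to `w`
in `H¹(Ω)`. -/
def HasTrace (Ω Γ : Set Plane) (w : H1 Ω) (g : Plane → ℝ) : Prop :=
  MemLp g 2 (arcLength Γ) ∧
  ∃ s : ℕ → Plane → ℝ, (∀ n, ContDiff ℝ ∞ (s n)) ∧
    Tendsto (fun n => eLpNorm (fun x => s n x - H1.toL2 w x) 2 (volume.restrict Ω)) atTop (𝓝 0) ∧
    (∀ i, Tendsto (fun n => eLpNorm (fun x => pderiv i (s n) x - H1.partial w i x) 2
      (volume.restrict Ω)) atTop (𝓝 0)) ∧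
    Tendsto (fun n => eLpNorm (fun x => s n x - g x) 2 (arcLength Γ)) atTop (𝓝 0)

/-- The vector field `G` is the trace on `Γ` of the gradient of `u ∈ H²(Ω)`. -/
def HasGradientTrace (Ω Γ : Set Plane) (u : H2 Ω) (G : Plane → Plane) : Prop :=
  ∀ i, HasTrace Ω Γ (H2.partial u i) (fun x => G x i)

/-! ### Functions of time -/

/-- The Bochner space `L²(0,T;X)`. -/
abbrev L2Time (T : ℝ) (X : Type*) [NormedAddCommGroup X] : Type _ :=
  Lp X 2 (volume.restrict (Ioo (0 : ℝ) T))

/-- `w` is the weak derivative of `u` on the time interval `(0,T)`. -/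
def HasWeakTimeDeriv {X : Type*} [NormedAddCommGroup X] [NormedSpace ℝ X] (T : ℝ)
    (u w : ℝ → X) : Prop :=
  ∀ η : ℝ → ℝ, IsTestFun (Ioo (0 : ℝ) T) η →
    ∫ t in Ioo (0 : ℝ) T, deriv η t • u t = -∫ t in Ioo (0 : ℝ) T, η t • w t

/-- `u|_{t=0} = a`: the function `u` on `(0,T)` agrees almost everywhere with a continuous function
on `[0,T]` whose value at `0` is `a`. -/
def HasInitialValue {X : Type*} [NormedAddCommGroup X] (T : ℝ) (u : ℝ → X) (a : X) : Prop :=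
  ∃ v : ℝ → X, ContinuousOn v (Icc 0 T) ∧ u =ᵐ[volume.restrict (Ioo (0 : ℝ) T)] v ∧ v 0 = a

/-! ### The coupled initial-boundary value problem -/

/-- `φ ∈ L²(0,T;H²(Ω))` satisfies `Δφ - c⁻² ∂ₜ²φ = 0` in `Ω × (0,T)` and
`φ|_{t=0} = ∂ₜφ|_{t=0} = 0` in `Ω`. -/
def SolvesWave (Ω : Set Plane) (T c : ℝ) (φ : L2Time T (H2 Ω)) : Prop :=
  ∃ φ₁ φ₂ : L2Time T (L2 Ω),
    HasWeakTimeDeriv T (fun t => H2.toL2 (φ t)) φ₁ ∧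
    HasWeakTimeDeriv T φ₁ φ₂ ∧
    (∀ᵐ t ∂volume.restrict (Ioo (0 : ℝ) T), H2.laplacian (φ t) - (1 / c ^ 2) • φ₂ t = 0) ∧
    HasInitialValue T (fun t => H2.toL2 (φ t)) 0 ∧
    HasInitialValue T φ₁ 0

/-- `Ω = B_R \ closure D`, where `B_R` is the open disc of radius `R` about the origin. -/
def annularDomain (D : Set Plane) (R : ℝ) : Set Plane := Metric.ball 0 R \ closure D

/-- `(φ, ψ)` is a solution of the coupled initial-boundary value problem with speeds `c₁`, `c₂` and
boundary data `f₁`, `f₂`. -/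
structure IsCoupledSolution (D : Set Plane) (R T c₁ c₂ : ℝ) (f₁ f₂ : ℝ → Plane → ℝ)
    (φ ψ : L2Time T (H2 (annularDomain D R))) : Prop where
  /-- the wave equation and the initial conditions for `φ` -/
  wave_φ : SolvesWave (annularDomain D R) T c₁ φ
  /-- the wave equation and the initial conditions for `ψ` -/
  wave_ψ : SolvesWave (annularDomain D R) T c₂ ψ
  /-- `∂_ν φ + ∂_τ ψ = f₁` and `∂_τ φ - ∂_ν ψ = f₂` on `∂D × (0,T)` -/
  coupled : ∀ᵐ t ∂volume.restrict (Ioo (0 : ℝ) T), ∃ G H : Plane → Plane,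
    HasGradientTrace (annularDomain D R) (frontier D) (φ t) G ∧
    HasGradientTrace (annularDomain D R) (frontier D) (ψ t) H ∧
    ∀ᵐ x ∂arcLength (frontier D),
      inner ℝ (outerNormal D x) (G x) + inner ℝ (tangent D x) (H x) = f₁ t x ∧
      inner ℝ (tangent D x) (G x) - inner ℝ (outerNormal D x) (H x) = f₂ t x
  /-- `φ = 0` and `ψ = 0` on `∂B_R × (0,T)` -/
  outer : ∀ᵐ t ∂volume.restrict (Ioo (0 : ℝ) T),
    HasTrace (annularDomain D R) (Metric.sphere 0 R) (H2.toH1 (φ t)) 0 ∧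
    HasTrace (annularDomain D R) (Metric.sphere 0 R) (H2.toH1 (ψ t)) 0

end

/-! By linearity it suffices to treat zero data. With coordinates numbered 0 and 1, put U = ∂₀φ +
∂₁ψ and V = ∂₁φ - ∂₀ψ. The coupled boundary conditions say that the ν- and τ-components of (U, V)
vanish, so U and V have zero trace on ∂D (`hasTrace_displacement`). Moreover ∂₀U + ∂₁V = Δφ and ∂₁U
- ∂₀V = Δψ. Integrating by parts (U, V) at a time s, which vanishes on ∂D, against φ, ψ at another
time t, which vanish on the outer circle, leaves no boundary term: (Δφ(s), φ(t)) + (Δψ(s), ψ(t)) +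
(U(s), U(t)) + (V(s), V(t)) = 0 (`inner_laplacian_add_inner_laplacian`).

The usual energy argument tests with ∂ₜφ, which is only L² in space; using two independent times
avoids this. Insert the wave equations and integrate over s in (0, t): since the initial velocities
vanish, c₁⁻²(φ'(t), φ(t)) + c₂⁻²(ψ'(t), ψ(t)) + (∫₀ᵗU, U(t)) + (∫₀ᵗV, V(t)) = 0. Every term is half
the derivative of a squared norm, so a second integration shows that a sum of squares vanishes
(`ae_eq_zero_of_energy`).

In `green_formula` traces are limits of smooth functions, so the exact divergence theorem is not
needed: it is enough to bound fluxes of smooth functions by integrals over the boundary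
(`HasFluxBound`). The bound comes from graph coordinates near ∂D and from chords in the disc;
cutoffs separate the two boundary components. -/

noncomputable section


/-! ### Primitives of vector valued functions -/

/-- Fubini for B (f a) (g b) on the square (0, t]², split along the diagonal: each triangle gives
one term. This is integration by parts for primitives of merely integrable functions. -/
theorem integral_bilin_primitive {E F G : Type*}
    [NormedAddCommGroup E] [NormedSpace ℝ E] [CompleteSpace E]
    [NormedAddCommGroup F] [NormedSpace ℝ F] [CompleteSpace F]
    [NormedAddCommGroup G] [NormedSpace ℝ G] [CompleteSpace G]
    (B : E →L[ℝ] F →L[ℝ] G) {f : ℝ → E} {g : ℝ → F} {t : ℝ}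
    (hf : IntegrableOn f (Ioc 0 t)) (hg : IntegrableOn g (Ioc 0 t)) :
    (∫ a in Ioc 0 t, B (∫ s in Ioc 0 a, f s) (g a)) +
      ∫ a in Ioc 0 t, B (f a) (∫ s in Ioc 0 a, g s) =
    B (∫ s in Ioc 0 t, f s) (∫ s in Ioc 0 t, g s) := by
  set m : Measure ℝ := volume.restrict (Ioc 0 t) with hm
  have hint : Integrable (fun z : ℝ × ℝ => B (f z.1) (g z.2)) (m.prod m) :=
    Integrable.op_fst_snd (op := fun x y => B x y) (by fun_prop)
      ⟨‖B‖, B.le_opNorm₂⟩ hf hg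
  have hs : MeasurableSet {z : ℝ × ℝ | z.1 ≤ z.2} :=
    measurableSet_le measurable_fst measurable_snd
  rw [← integral_prod_bilin B (μ := m) (ν := m) hf hg, ← integral_add_compl hs hint]
  congr 1
  · rw [← integral_indicator hs, integral_prod_symm _ (hint.indicator hs)]
    refine setIntegral_congr_fun measurableSet_Ioc fun b hb => ?_
    have h1 : ∀ a, {z : ℝ × ℝ | z.1 ≤ z.2}.indicator (fun z : ℝ × ℝ => B (f z.1) (g z.2)) (a, b)
        = (Iic b).indicator (fun a => B (f a) (g b)) a := fun a => by
      simp [indicator]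
    simp only [h1]
    rw [integral_indicator measurableSet_Iic, hm, Measure.restrict_restrict measurableSet_Iic]
    have h2 : Iic b ∩ Ioc 0 t = Ioc 0 b := by
      ext x; simp only [mem_inter_iff, mem_Iic, mem_Ioc]
      exact ⟨fun h => ⟨h.2.1, h.1⟩, fun h => ⟨h.2, h.1, h.2.trans hb.2⟩⟩
    rw [h2]
    have := ContinuousLinearMap.integral_comp_comm (B.flip (g b))
      (hf.mono_set (Ioc_subset_Ioc_right hb.2))
    simpa using this.symm
  · rw [← integral_indicator hs.compl, integral_prod _ (hint.indicator hs.compl)]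
    refine setIntegral_congr_fun measurableSet_Ioc fun a ha => ?_
    have h1 : ∀ b, {z : ℝ × ℝ | z.1 ≤ z.2}ᶜ.indicator
        (fun z : ℝ × ℝ => B (f z.1) (g z.2)) (a, b)
        = (Iio a).indicator (fun b => B (f a) (g b)) b := fun b => by
      simp [indicator]
    simp only [h1]
    rw [integral_indicator measurableSet_Iio, hm, Measure.restrict_restrict measurableSet_Iio]
    have h2 : Iio a ∩ Ioc 0 t = Ioo 0 a := by
      ext x; simp only [mem_inter_iff, mem_Iio, mem_Ioo, mem_Ioc]
      exact ⟨fun h => ⟨h.2.1, h.1⟩, fun h => ⟨h.2, h.1, h.2.le.trans ha.2⟩⟩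
    rw [h2, ← integral_Ioc_eq_integral_Ioo]
    exact (ContinuousLinearMap.integral_comp_comm (B (f a))
      (hg.mono_set (Ioc_subset_Ioc_right ha.2))).symm

/-- For the inner product both triangles contribute equally. -/
theorem norm_sq_primitive {X : Type*} [NormedAddCommGroup X] [InnerProductSpace ℝ X]
    [CompleteSpace X] {f : ℝ → X} {t : ℝ} (hf : IntegrableOn f (Ioc 0 t)) :
    2 * ∫ a in Ioc 0 t, inner ℝ (∫ s in Ioc 0 a, f s) (f a) = ‖∫ s in Ioc 0 t, f s‖ ^ 2 := by
  have h : (∫ a in Ioc 0 t, inner ℝ (∫ s in Ioc 0 a, f s) (f a)) +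
      ∫ a in Ioc 0 t, inner ℝ (f a) (∫ s in Ioc 0 a, f s) =
      inner ℝ (∫ s in Ioc 0 t, f s) (∫ s in Ioc 0 t, f s) :=
    integral_bilin_primitive (innerSL ℝ (E := X)) hf hf
  rw [← real_inner_self_eq_norm_sq, ← h, two_mul]
  congr 1
  exact integral_congr_ae (ae_of_all _ fun a => real_inner_comm _ _)

/-! ### Test functions and weak derivatives in time -/

/-- A test function of vanishing integral is the derivative of a test function. -/
theorem IsTestFun.exists_deriv_eq {T : ℝ} {η : ℝ → ℝ} (hη : IsTestFun (Ioo 0 T) η)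
    (h0 : ∫ t in Ioo 0 T, η t = 0) :
    ∃ ζ : ℝ → ℝ, IsTestFun (Ioo 0 T) ζ ∧ deriv ζ = η := by
  obtain ⟨hs, hc, hsub⟩ := hη
  rcases (tsupport η).eq_empty_or_nonempty with he | hne
  · refine ⟨0, ⟨contDiff_const, HasCompactSupport.zero, by simp [tsupport]⟩, ?_⟩
    rw [tsupport_eq_empty_iff] at he
    rw [he]; ext; simp
  have hK : IsCompact (tsupport η) := hc
  obtain ⟨a, ha, hamin⟩ := hK.exists_isLeast hne
  obtain ⟨b, hb, hbmax⟩ := hK.exists_isGreatest hne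
  have ha' := hsub ha
  have hb' := hsub hb
  have hzero : ∀ x, x ∉ Icc a b → η x = 0 := fun x hx => by
    by_contra h
    have := subset_tsupport η h
    exact hx ⟨hamin this, hbmax this⟩
  have hint : Integrable η := hs.continuous.integrable_of_hasCompactSupport hc
  have hder : ∀ x, HasDerivAt (fun x => ∫ t in (0 : ℝ)..x, η t) (η x) x := fun x =>
    intervalIntegral.integral_hasDerivAt_right (hs.continuous.intervalIntegrable _ _)
      (hs.continuous.stronglyMeasurableAtFilter _ _) hs.continuous.continuousAt
  have hd : deriv (fun x => ∫ t in (0 : ℝ)..x, η t) = η := funext fun x => (hder x).deriv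
  -- To the left of the support the integrand vanishes; to its right the primitive equals the full
  -- integral, which is zero by `h0`.
  have hts : tsupport (fun x => ∫ t in (0 : ℝ)..x, η t) ⊆ Icc a b := by
    refine closure_minimal (fun x hx => ?_) isClosed_Icc
    by_contra hxn
    apply hx
    rw [mem_Icc, not_and_or, not_le, not_le] at hxn
    rcases hxn with hxa | hxb
    · refine intervalIntegral.integral_zero_ae (ae_of_all _ fun y hy => hzero y fun hy2 => ?_)
      have : y ≤ max 0 x := hy.2
      have := this.trans_lt (max_lt ha'.1 hxa)
      exact absurd hy2.1 (not_le.2 this)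
    · have hx0 : 0 ≤ x := (hb'.1.trans hxb).le
      have e : ∀ c, b < c → ∫ t in (0 : ℝ)..c, η t = ∫ t, η t := fun c hbc => by
        rw [intervalIntegral.integral_of_le (hb'.1.trans hbc).le]
        refine setIntegral_eq_integral_of_forall_compl_eq_zero fun y hy => hzero y fun hy2 => hy ?_
        exact ⟨ha'.1.trans_le hy2.1, hy2.2.trans hbc.le⟩
      change ∫ t in (0 : ℝ)..x, η t = 0
      rw [e x hxb, ← e T hb'.2, intervalIntegral.integral_of_le (hb'.1.trans hb'.2).le,
        integral_Ioc_eq_integral_Ioo, h0]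
  refine ⟨fun x => ∫ t in (0 : ℝ)..x, η t, ⟨?_, ?_, ?_⟩, hd⟩
  · rw [contDiff_infty_iff_deriv, hd]
    exact ⟨fun x => (hder x).differentiableAt, hs⟩
  · exact isCompact_Icc.of_isClosed_subset (isClosed_tsupport _) hts
  · exact hts.trans fun x hx => ⟨ha'.1.trans_le hx.1, hx.2.trans_lt hb'.2⟩

theorem exists_isTestFun_integral_eq_one {T : ℝ} (hT : 0 < T) :
    ∃ θ : ℝ → ℝ, IsTestFun (Ioo 0 T) θ ∧ ∫ t in Ioo 0 T, θ t = 1 := by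
  let f : ContDiffBump (T / 2) := ⟨T / 8, T / 4, by positivity, by linarith⟩
  have hsub : tsupport (f.normed volume) ⊆ Ioo 0 T := by
    rw [f.tsupport_normed_eq]
    intro x hx
    rw [Metric.mem_closedBall, Real.dist_eq, abs_le] at hx
    change -(T / 4) ≤ _ ∧ _ ≤ T / 4 at hx
    constructor <;> linarith [hx.1, hx.2]
  refine ⟨f.normed volume, ⟨f.contDiff_normed, f.hasCompactSupport_normed, hsub⟩, ?_⟩
  rw [setIntegral_eq_integral_of_forall_compl_eq_zero, f.integral_normed]
  intro x hx
  exact image_eq_zero_of_notMem_tsupport fun h => hx (hsub h)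

theorem IsTestFun.sub_smul {T : ℝ} {η θ : ℝ → ℝ} (hη : IsTestFun (Ioo 0 T) η)
    (hθ : IsTestFun (Ioo 0 T) θ) (c : ℝ) : IsTestFun (Ioo 0 T) (fun t => η t - c * θ t) := by
  have h2 : tsupport (fun t => c * θ t) ⊆ tsupport θ := tsupport_mul_subset_right
  refine ⟨hη.1.sub (contDiff_const.mul hθ.1), hη.2.1.sub hθ.2.1.mul_left, ?_⟩
  exact (tsupport_sub _ _).trans (union_subset hη.2.2 (h2.trans hθ.2.2))

/-- The lemma of du Bois-Reymond. -/
theorem eq_const_of_weak_deriv_eq_zero {X : Type*} [NormedAddCommGroup X] [NormedSpace ℝ X]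
    [CompleteSpace X] {T : ℝ} (hT : 0 < T) {z : ℝ → X} (hz : ContinuousOn z (Icc 0 T))
    (h : ∀ η : ℝ → ℝ, IsTestFun (Ioo 0 T) η → ∫ t in Ioo 0 T, deriv η t • z t = 0) :
    ∀ t ∈ Icc 0 T, z t = z 0 := by
  obtain ⟨θ, hθ, hθ1⟩ := exists_isTestFun_integral_eq_one hT
  have hzi : IntegrableOn z (Ioo 0 T) :=
    (hz.integrableOn_compact isCompact_Icc).mono_set Ioo_subset_Icc_self
  have hsm : ∀ {η : ℝ → ℝ}, IsTestFun (Ioo 0 T) η →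
      IntegrableOn (fun t => η t • z t) (Ioo 0 T) := fun {η} hη => by
    obtain ⟨C, hC⟩ := hη.2.1.exists_bound_of_continuous hη.1.continuous
    exact Integrable.bdd_smul hzi C hη.1.continuous.aestronglyMeasurable (ae_of_all _ hC)
  have hint1 : ∀ {η : ℝ → ℝ}, IsTestFun (Ioo 0 T) η → IntegrableOn η (Ioo 0 T) := fun hη =>
    (hη.1.continuous.integrable_of_hasCompactSupport hη.2.1).integrableOn
  set k : X := ∫ t in Ioo 0 T, θ t • z t with hk
  have hae : ∀ᵐ t ∂(volume : Measure ℝ), t ∈ Ioo 0 T → z t - k = 0 := by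
    refine isOpen_Ioo.ae_eq_zero_of_integral_contDiff_smul_eq_zero
      (IntegrableOn.locallyIntegrableOn
        (hzi.sub (integrableOn_const (by simp)))) fun η h1 h2 h3 => ?_
    have hη : IsTestFun (Ioo 0 T) η := ⟨h1, h2, h3⟩
    -- Since θ has integral one, η - cθ has integral zero and is the derivative of a test function.
    -- Hence ∫ η z = c k, which says that z - k annihilates η.
    set c := ∫ t in Ioo 0 T, η t with hc
    obtain ⟨ζ, hζ, hζd⟩ := (hη.sub_smul hθ c).exists_deriv_eq (by
      rw [integral_sub (hint1 hη) ((hint1 hθ).const_mul c), integral_const_mul, hθ1]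
      simp [hc])
    have h4 := h ζ hζ
    rw [hζd] at h4
    simp only [sub_smul, mul_smul] at h4
    rw [integral_sub (g := fun t => c • θ t • z t) (hsm hη) (Integrable.smul c (hsm hθ)), integral_smul, ← hk] at h4
    rw [← setIntegral_eq_integral_of_forall_compl_eq_zero (s := Ioo 0 T) (fun x hx => by
      rw [image_eq_zero_of_notMem_tsupport fun h => hx (h3 h), zero_smul])]
    simp only [smul_sub]
    rw [integral_sub (hsm hη) ((hint1 hη).smul_const k), integral_smul_const, h4]
  have hIoo : ∀ t ∈ Ioo 0 T, z t = k := by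
    have h5 : z =ᵐ[volume.restrict (Ioo 0 T)] fun _ => k := by
      rw [Filter.EventuallyEq, ae_restrict_iff' measurableSet_Ioo]
      filter_upwards [hae] with t ht ht' using sub_eq_zero.1 (ht ht')
    exact Measure.eqOn_open_of_ae_eq h5 isOpen_Ioo (hz.mono Ioo_subset_Icc_self)
      continuousOn_const
  have hIcc : ∀ t ∈ Icc 0 T, z t = k := by
    have h6 : EqOn z (fun _ => k) (Icc 0 T) := by
      refine EqOn.of_subset_closure (fun t ht => hIoo t ht) hz continuousOn_const
        Ioo_subset_Icc_self ?_
      rw [closure_Ioo hT.ne]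
    exact h6
  intro t ht
  rw [hIcc t ht, hIcc 0 ⟨le_rfl, hT.le⟩]

/-- The continuous representative of `u` and the primitive of `w` have the same weak derivative, so
they differ by a constant, which is zero because both vanish at time 0. -/
theorem eq_primitive_of_hasWeakTimeDeriv {X : Type*} [NormedAddCommGroup X] [NormedSpace ℝ X]
    [CompleteSpace X] {T : ℝ} (hT : 0 < T) {u w : ℝ → X} (hw : IntegrableOn w (Ioo 0 T))
    (hu : HasWeakTimeDeriv T u w) (h0 : HasInitialValue T u 0) :
    ∀ᵐ t ∂volume.restrict (Ioo 0 T), u t = ∫ s in Ioc 0 t, w s := by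
  obtain ⟨v, hv, huv, hv0⟩ := h0
  have hw' : IntegrableOn w (Icc 0 T) := by rwa [integrableOn_Icc_iff_integrableOn_Ioo]
  have hW : ContinuousOn (fun t => ∫ s in Ioc 0 t, w s) (Icc 0 T) :=
    intervalIntegral.continuousOn_primitive hw'
  have hsm : ∀ {η : ℝ → ℝ}, IsTestFun (Ioo 0 T) η → ∀ {f : ℝ → X}, ContinuousOn f (Icc 0 T) →
      IntegrableOn (fun t => deriv η t • f t) (Ioo 0 T) := fun {η} hη f hf => by
    refine (ContinuousOn.integrableOn_compact isCompact_Icc ?_).mono_set Ioo_subset_Icc_self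
    exact (hη.1.continuous_deriv (by simp)).continuousOn.smul hf
  have hz := eq_const_of_weak_deriv_eq_zero hT (z := fun t => v t - ∫ s in Ioc 0 t, w s)
    (hv.sub hW) fun η hη => by
      simp only [smul_sub]
      rw [integral_sub (hsm hη hv) (hsm hη hW)]
      have e1 : ∫ t in Ioo 0 T, deriv η t • v t = ∫ t in Ioo 0 T, deriv η t • u t :=
        integral_congr_ae (huv.mono fun t ht => by simp only [ht])
      have hder : IntegrableOn (deriv η) (Ioc 0 T) :=
        ((hη.1.continuous_deriv (by simp)).integrable_of_hasCompactSupport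
          hη.2.1.deriv).integrableOn
      have h00 : ∀ {x}, x ∉ Ioo 0 T → η x = 0 := fun {x} hx =>
        image_eq_zero_of_notMem_tsupport fun h => hx (hη.2.2 h)
      have e0 : ∀ t, 0 ≤ t → ∫ s in Ioc 0 t, deriv η s = η t := fun t ht => by
        rw [← intervalIntegral.integral_of_le ht, intervalIntegral.integral_deriv_eq_sub
          (fun x _ => (hη.1.differentiable (by simp)) x)
          ((hη.1.continuous_deriv (by simp)).intervalIntegrable _ _), h00 (x := 0) (by simp)]
        simp
      have e2 := integral_bilin_primitive (ContinuousLinearMap.lsmul ℝ ℝ (E := X)) hder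
        (hw.congr_set_ae Ioo_ae_eq_Ioc.symm)
      simp only [ContinuousLinearMap.lsmul_apply] at e2
      rw [e0 T hT.le, h00 (x := T) (by simp), zero_smul, integral_Ioc_eq_integral_Ioo,
        integral_Ioc_eq_integral_Ioo] at e2
      have e3 : ∫ a in Ioo 0 T, (∫ s in Ioc 0 a, deriv η s) • w a = ∫ a in Ioo 0 T, η a • w a :=
        setIntegral_congr_fun measurableSet_Ioo fun t ht => by simp only [e0 t ht.1.le]
      rw [e3] at e2
      rw [e1, hu η hη, sub_eq_zero, neg_eq_iff_add_eq_zero, e2]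
  filter_upwards [huv, ae_restrict_mem measurableSet_Ioo] with t ht htm
  have := hz t (Ioo_subset_Icc_self htm)
  simp only [hv0, Ioc_self, Measure.restrict_empty, integral_zero_measure, sub_zero] at this
  rw [ht, sub_eq_zero.1 this]


/-! ### Fluxes through graphs -/

/-- A parametrized curve that is a section of a `1`-Lipschitz function has push-forward measure at
most the arc length. -/
theorem map_restrict_le_arcLength {q : ℝ → Plane} (hq : Measurable q) {p : Plane → ℝ}
    (hp : LipschitzWith 1 p) {J : Set ℝ} {Γ : Set Plane}
    (hpq : ∀ t ∈ J, p (q t) = t) (hΓ : ∀ t ∈ J, q t ∈ Γ) :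
    (volume.restrict J).map q ≤ arcLength Γ := by
  refine Measure.le_iff.2 fun A hA => ?_
  rw [Measure.map_apply hq hA, Measure.restrict_apply (hq hA), arcLength,
    Measure.restrict_apply hA]
  -- Projecting the arc back by `p` recovers the parameters, and a `1`-Lipschitz map does not
  -- increase `μH[1]`. This one-sided comparison replaces the arc length formula.
  calc volume (q ⁻¹' A ∩ J) ≤ volume (p '' (A ∩ Γ)) :=
        measure_mono fun t ht => ⟨q t, ⟨ht.1, hΓ t ht.2⟩, hpq t ht.2⟩
    _ ≤ μH[1] (A ∩ Γ) := by
        rw [← hausdorffMeasure_real]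
        simpa using hp.hausdorffMeasure_image_le zero_le_one (A ∩ Γ)

theorem lipschitzWith_coord (i : Fin 2) : LipschitzWith 1 (fun y : Plane => y i) :=
  LipschitzWith.of_dist_le_mul fun x y => by
    rw [NNReal.coe_one, one_mul, dist_eq_norm, dist_eq_norm]
    exact PiLp.norm_apply_le (x - y) i

theorem measurePreserving_plane : MeasurePreserving (fun p : ℝ × ℝ => (!₂[p.1, p.2] : Plane)) :=
  (PiLp.volume_preserving_toLp (Fin 2)).comp (volume_preserving_finTwoArrow ℝ).symm

/-- Coordinates straightening the graph of `γ` in the frame given by `L`. -/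
def graphMap (L : Plane ≃ₗᵢ[ℝ] Plane) (γ : ℝ → ℝ) (p : ℝ × ℝ) : Plane :=
  L.symm !₂[p.1, γ p.1 + p.2]

section graphMap

variable {L : Plane ≃ₗᵢ[ℝ] Plane} {γ : ℝ → ℝ}

theorem graphMap_eq (p : ℝ × ℝ) : graphMap L γ p =
    p.1 • L.symm (EuclideanSpace.single 0 1) +
      (γ p.1 + p.2) • L.symm (EuclideanSpace.single 1 1) := by
  rw [graphMap, ← map_smul, ← map_smul, ← map_add]
  congr 1
  ext i; fin_cases i <;> simp

theorem apply_graphMap_zero (p : ℝ × ℝ) : L (graphMap L γ p) 0 = p.1 := by simp [graphMap]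

theorem apply_graphMap_one (p : ℝ × ℝ) : L (graphMap L γ p) 1 = γ p.1 + p.2 := by
  simp [graphMap]

theorem continuous_graphMap (hγ : Continuous γ) : Continuous (graphMap L γ) := by
  rw [show graphMap L γ = _ from funext graphMap_eq]
  fun_prop

theorem measurePreserving_graphMap (hγ : Continuous γ) : MeasurePreserving (graphMap L γ) := by
  have h : MeasurePreserving (fun p : ℝ × ℝ => (p.1, γ p.1 + p.2))
      (volume.prod volume) (volume.prod volume) :=
    (MeasurePreserving.id volume).skew_product (g := fun a b => γ a + b)
      (by unfold Function.uncurry; fun_prop)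
      (ae_of_all _ fun a => (measurePreserving_add_left volume (γ a)).map_eq)
  exact L.symm.measurePreserving.comp (measurePreserving_plane.comp h)

theorem hasDerivAt_graphMap_snd {f : Plane → ℝ} (hf : ContDiff ℝ ∞ f) (t h : ℝ) :
    HasDerivAt (fun h => f (graphMap L γ (t, h)))
      (fderiv ℝ f (graphMap L γ (t, h)) (L.symm (EuclideanSpace.single 1 1))) h := by
  refine ((hf.differentiable (by simp)) _).hasFDerivAt.comp_hasDerivAt h ?_
  simp only [show graphMap L γ = _ from funext graphMap_eq]
  simpa using (((hasDerivAt_id h).const_add (γ t)).smul_const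
    (L.symm (EuclideanSpace.single 1 (1 : ℝ)))).const_add
      (t • L.symm (EuclideanSpace.single 0 (1 : ℝ)))

theorem hasDerivAt_graphMap_fst {f : Plane → ℝ} (hf : ContDiff ℝ ∞ f) (hγ : ContDiff ℝ ∞ γ)
    (t h : ℝ) :
    HasDerivAt (fun t => f (graphMap L γ (t, h)))
      (fderiv ℝ f (graphMap L γ (t, h)) (L.symm (EuclideanSpace.single 0 1) +
        deriv γ t • L.symm (EuclideanSpace.single 1 1))) t := by
  refine ((hf.differentiable (by simp)) _).hasFDerivAt.comp_hasDerivAt t ?_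
  simp only [show graphMap L γ = _ from funext graphMap_eq]
  have h1 : HasDerivAt γ (deriv γ t) t := ((hγ.differentiable (by simp)) t).hasDerivAt
  simpa using ((hasDerivAt_id t).smul_const (L.symm (EuclideanSpace.single 0 (1 : ℝ)))).fun_add
    ((h1.add_const h).smul_const (L.symm (EuclideanSpace.single 1 (1 : ℝ))))

theorem hasCompactSupport_comp_graphMap (hγ : Continuous γ) {F : Plane → ℝ}
    (hF : HasCompactSupport F) : HasCompactSupport (fun p => F (graphMap L γ p)) := by
  have hc : Continuous fun y : Plane => (L y 0, L y 1 - γ (L y 0)) := by fun_prop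
  refine HasCompactSupport.intro (hF.image hc) fun p hp => image_eq_zero_of_notMem_tsupport
    fun h => hp ⟨_, h, ?_⟩
  simp only [apply_graphMap_zero, apply_graphMap_one, add_sub_cancel_left]

/-- The flux of `f` through the lower side of a graph, for `f` supported where the graph bounds
the set `S`. -/
theorem setIntegral_fderiv_of_graph {S U : Set Plane} (hS : MeasurableSet S)
    (hγ : ContDiff ℝ ∞ γ) (hSU : ∀ y ∈ U, y ∈ S ↔ L y 1 < γ (L y 0))
    {f : Plane → ℝ} (hf : IsTestFun U f) (v : Plane) :
    ∫ y in S, fderiv ℝ f y v =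
      ∫ t, (L v 1 - L v 0 * deriv γ t) * f (graphMap L γ (t, 0)) := by
  obtain ⟨hfs, hfc, hfU⟩ := hf
  have hmp := measurePreserving_graphMap (L := L) hγ.continuous
  have hcont := continuous_graphMap (L := L) hγ.continuous
  have hFc : Continuous (fderiv ℝ f) := hfs.continuous_fderiv (by simp)
  have hγc : Continuous (deriv γ) := hγ.continuous_deriv (by simp)
  have hF0 : ∀ w y, y ∉ U → fderiv ℝ f y w = 0 := fun w y hy => by
    rw [image_eq_zero_of_notMem_tsupport
      (f := fderiv ℝ f) fun h => hy (hfU (tsupport_fderiv_subset ℝ h))]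
    simp
  have e1 : ∫ y in S, fderiv ℝ f y v =
      ∫ p in {p : ℝ × ℝ | p.2 < 0}, fderiv ℝ f (graphMap L γ p) v := by
    rw [← integral_indicator hS, ← integral_indicator (measurableSet_lt measurable_snd
      measurable_const), ← hmp.map_eq, integral_map hmp.measurable.aemeasurable]
    · refine integral_congr_ae (ae_of_all _ fun p => ?_)
      by_cases hU : graphMap L γ p ∈ U
      · have := hSU _ hU
        rw [apply_graphMap_zero, apply_graphMap_one, add_lt_iff_neg_left] at this
        simp only [indicator, this, mem_ofPred_eq]
      · simp [indicator, hF0 _ _ hU]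
    · exact ((hFc.clm_apply continuous_const).stronglyMeasurable.indicator hS).aestronglyMeasurable
  have hr : (volume : Measure (ℝ × ℝ)).restrict {p : ℝ × ℝ | p.2 < 0} =
      volume.prod (volume.restrict (Iio 0)) := by
    have : {p : ℝ × ℝ | p.2 < 0} = univ ×ˢ Iio 0 := by ext; simp
    rw [this, Measure.volume_eq_prod, ← Measure.prod_restrict, Measure.restrict_univ]
  set e₀ := L.symm (EuclideanSpace.single 0 (1 : ℝ)) with he₀
  set e₁ := L.symm (EuclideanSpace.single 1 (1 : ℝ)) with he₁
  have hv : v = L v 0 • e₀ + L v 1 • e₁ := by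
    apply L.injective
    rw [map_add, map_smul, map_smul, he₀, he₁, L.apply_symm_apply, L.apply_symm_apply]
    ext i; fin_cases i <;> simp
  have hcs : ∀ G : ℝ × ℝ → Plane,
      HasCompactSupport fun p => fderiv ℝ f (graphMap L γ p) (G p) := fun G => by
    have := hasCompactSupport_comp_graphMap (L := L) hγ.continuous (hfc.fderiv ℝ).norm
    refine this.mono fun p hp => ?_
    rw [Function.mem_support] at hp ⊢
    intro h
    rw [norm_eq_zero] at h
    exact hp (by simp [h])
  have hint : ∀ G : ℝ × ℝ → Plane, Continuous G →
      Integrable (fun p => fderiv ℝ f (graphMap L γ p) (G p))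
        (volume.prod (volume.restrict (Iio 0))) := fun G hG => by
    rw [← hr]
    exact (((hFc.comp hcont).clm_apply hG).integrable_of_hasCompactSupport (hcs G)).integrableOn
  have hg0 := hasCompactSupport_comp_graphMap (L := L) hγ.continuous hfc
  have hslice : ∀ {G : ℝ × ℝ → ℝ}, HasCompactSupport G → ∀ h,
      HasCompactSupport fun t => G (t, h) := fun {G} hG h =>
    HasCompactSupport.intro (hG.image continuous_fst) fun t ht =>
      image_eq_zero_of_notMem_tsupport fun h' => ht ⟨_, h', rfl⟩
  have hslice' : ∀ {G : ℝ × ℝ → ℝ}, HasCompactSupport G → ∀ t,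
      HasCompactSupport fun h => G (t, h) := fun {G} hG h =>
    HasCompactSupport.intro (hG.image continuous_snd) fun t ht =>
      image_eq_zero_of_notMem_tsupport fun h' => ht ⟨_, h', rfl⟩
  have hG1 : Continuous fun p : ℝ × ℝ => L v 0 • (e₀ + deriv γ p.1 • e₁) := by fun_prop
  have hG2 : Continuous fun p : ℝ × ℝ => (L v 1 - L v 0 * deriv γ p.1) • e₁ := by fun_prop
  -- Split v into a part tangent to the vertically shifted graphs and a vertical part. The first
  -- integrates to zero along each shifted graph (`z1`); the second is handled by the fundamental
  -- theorem of calculus on each vertical half-line (`z2`).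
  have e2 : ∀ p : ℝ × ℝ, fderiv ℝ f (graphMap L γ p) v =
      fderiv ℝ f (graphMap L γ p) (L v 0 • (e₀ + deriv γ p.1 • e₁)) +
      fderiv ℝ f (graphMap L γ p) ((L v 1 - L v 0 * deriv γ p.1) • e₁) := fun p => by
    rw [← map_add]
    congr 1
    conv_lhs => rw [hv]
    module
  rw [e1, hr]
  simp only [e2]
  rw [integral_add (hint _ hG1) (hint _ hG2), integral_prod_symm _ (hint _ hG1),
    integral_prod _ (hint _ hG2)]
  have hG3 : Continuous fun p : ℝ × ℝ =>
      fderiv ℝ f (graphMap L γ p) (e₀ + deriv γ p.1 • e₁) :=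
    (hFc.comp hcont).clm_apply (by fun_prop)
  have hG4 : Continuous fun p => f (graphMap L γ p) := hfs.continuous.comp hcont
  have z1 : ∀ h : ℝ, ∫ t, fderiv ℝ f (graphMap L γ (t, h))
      (L v 0 • (e₀ + deriv γ t • e₁)) = 0 := fun h => by
    simp only [map_smul _ (L v 0), smul_eq_mul]
    rw [integral_const_mul, integral_eq_zero_of_hasDerivAt_of_integrable
      (fun t => hasDerivAt_graphMap_fst hfs hγ t h), mul_zero]
    · exact (hG3.comp (Continuous.prodMk_left h)).integrable_of_hasCompactSupport
        (hslice (hcs fun p => e₀ + deriv γ p.1 • e₁) h)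
    · exact (hG4.comp (Continuous.prodMk_left h)).integrable_of_hasCompactSupport (hslice hg0 h)
  have z2 : ∀ t : ℝ, ∫ h in Iio 0, fderiv ℝ f (graphMap L γ (t, h))
      ((L v 1 - L v 0 * deriv γ t) • e₁) =
      (L v 1 - L v 0 * deriv γ t) * f (graphMap L γ (t, 0)) := fun t => by
    simp only [map_smul, smul_eq_mul]
    rw [integral_const_mul, ← integral_Iic_eq_integral_Iio]
    congr 1
    have hsm : ContDiff ℝ 1 fun h => f (graphMap L γ (t, h)) := by
      simp only [show graphMap L γ = _ from funext graphMap_eq]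
      exact (hfs.of_le (by simp)).comp
        (contDiff_const.add ((contDiff_const.add contDiff_id).smul contDiff_const))
    have := HasCompactSupport.integral_Iic_deriv_eq hsm (hslice' hg0 t) 0
    rw [← this]
    exact integral_congr_ae (ae_of_all _ fun h => (hasDerivAt_graphMap_snd hfs t h).deriv.symm)
  simp only [z1, z2, integral_zero, zero_add]

end graphMap

/-- The fluxes through the boundary of `S` of functions supported in `U` are controlled by a finite
measure, which is at most a multiple of the arc length on `Γ`. -/
def HasFluxBound (S Γ U : Set Plane) : Prop :=
  ∃ σ : Measure Plane, IsFiniteMeasure σ ∧ (∃ C : NNReal, σ ≤ C • arcLength Γ) ∧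
    ∀ f, IsTestFun U f → ∀ i, ‖∫ y in S, pderiv i f y‖ₑ ≤ ∫⁻ y, ‖f y‖ₑ ∂σ

theorem hasFluxBound_of_graph {S Γ : Set Plane} {x : Plane} {r : ℝ}
    {L : Plane ≃ₗᵢ[ℝ] Plane} {γ : ℝ → ℝ} (hS : MeasurableSet S)
    (hγ : ContDiff ℝ ∞ γ) (hSU : ∀ y ∈ Metric.ball x r, y ∈ S ↔ L y 1 < γ (L y 0))
    (hΓ : ∀ y ∈ Metric.ball x r, L y 1 = γ (L y 0) → y ∈ Γ) :
    HasFluxBound S Γ (Metric.ball x r) := by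
  have hcont : Continuous fun t : ℝ => graphMap L γ (t, 0) :=
    (continuous_graphMap (L := L) hγ.continuous).comp (by fun_prop)
  set J : Set ℝ := (fun t : ℝ => graphMap L γ (t, 0)) ⁻¹' Metric.ball x r with hJ
  have hJo : IsOpen J := Metric.isOpen_ball.preimage hcont
  have hJb : J ⊆ Metric.closedBall (L x 0) r := fun t ht => by
    have h1 : dist (L (graphMap L γ (t, 0)) 0) (L x 0) ≤ dist (graphMap L γ (t, 0)) x := by
      have := (lipschitzWith_coord 0).dist_le_mul (L (graphMap L γ (t, 0))) (L x)
      rwa [NNReal.coe_one, one_mul, L.dist_map] at this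
    rw [apply_graphMap_zero] at h1
    exact h1.trans (Metric.mem_ball.1 ht).le
  obtain ⟨C, hC⟩ := (isCompact_closedBall (L x 0) r).exists_bound_of_continuousOn
    (hγ.continuous_deriv (by simp)).continuousOn
  -- Bounds the density L v 1 - L v 0 γ' for a unit vector v: the components of L v are at most 1 in
  -- absolute value, and |γ'| ≤ C over the ball.
  set C' : NNReal := 1 + C.toNNReal with hC'
  set σ₀ : Measure Plane := (volume.restrict J).map fun t => graphMap L γ (t, 0) with hσ₀
  have hfin : IsFiniteMeasure (volume.restrict J) :=
    ⟨by rw [Measure.restrict_apply_univ]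
        exact (measure_mono hJb).trans_lt measure_closedBall_lt_top⟩
  have hle : σ₀ ≤ arcLength Γ := by
    refine map_restrict_le_arcLength hcont.measurable (p := fun y => L y 0) ?_
      (fun t _ => apply_graphMap_zero _) fun t ht => hΓ _ ht ?_
    · have := (lipschitzWith_coord 0).comp L.lipschitz
      rwa [one_mul] at this
    · rw [apply_graphMap_zero, apply_graphMap_one, add_zero]
  refine ⟨C' • σ₀, inferInstance, ⟨C', ?_⟩, fun f hf i => ?_⟩
  · exact Measure.le_iff'.2 fun A => by
      simp only [Measure.smul_apply]
      exact smul_le_smul_of_nonneg_left (hle A) zero_le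
  · have key := setIntegral_fderiv_of_graph hS hγ hSU hf (EuclideanSpace.single i 1)
    simp only [pderiv]
    rw [key]
    have hLv : ∀ j, |L (EuclideanSpace.single i 1) j| ≤ 1 := fun j => by
      have := PiLp.norm_apply_le (L (EuclideanSpace.single i (1 : ℝ))) j
      rwa [L.norm_map, PiLp.norm_single, norm_one] at this
    have hf0 : ∀ t ∉ J, f (graphMap L γ (t, 0)) = 0 := fun t ht =>
      image_eq_zero_of_notMem_tsupport fun h => ht (hf.2.2 h)
    have hfm : Measurable fun y => ‖f y‖ₑ := hf.1.continuous.measurable.enorm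
    rw [lintegral_smul_measure, hσ₀, lintegral_map hfm hcont.measurable,
      ← setIntegral_eq_integral_of_forall_compl_eq_zero (s := J)
        (fun t ht => by rw [hf0 t ht, mul_zero])]
    refine (enorm_integral_le_lintegral_enorm _).trans ?_
    rw [ENNReal.smul_def, smul_eq_mul, ← lintegral_const_mul' _ _ ENNReal.coe_ne_top]
    refine setLIntegral_mono' hJo.measurableSet fun t ht => ?_
    rw [enorm_mul]
    gcongr
    rw [enorm_le_coe, ← NNReal.coe_le_coe, coe_nnnorm, hC', NNReal.coe_add, NNReal.coe_one,
      Real.norm_eq_abs]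
    have h1 := hC t (hJb ht)
    rw [Real.norm_eq_abs] at h1
    calc |L (EuclideanSpace.single i 1) 1 - L (EuclideanSpace.single i 1) 0 * deriv γ t|
        ≤ |L (EuclideanSpace.single i 1) 1| +
          |L (EuclideanSpace.single i 1) 0| * |deriv γ t| := by
          rw [← abs_mul]; exact abs_sub _ _
      _ ≤ 1 + 1 * |deriv γ t| := by gcongr <;> exact hLv _
      _ ≤ 1 + C.toNNReal := by
          rw [one_mul]; gcongr; exact h1.trans (Real.le_coe_toNNReal C)


/-! ### Fluxes through the boundary of a planar domain -/

theorem IsTestFun.mono {E : Type*} [NormedAddCommGroup E] [NormedSpace ℝ E] {U V : Set E}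
    {f : E → ℝ} (hf : IsTestFun U f) (h : U ⊆ V) : IsTestFun V f :=
  ⟨hf.1, hf.2.1, hf.2.2.trans h⟩

theorem IsTestFun.mul_left {E : Type*} [NormedAddCommGroup E] [NormedSpace ℝ E] {U V : Set E}
    {f ρ : E → ℝ} (hf : IsTestFun V f) (hρ : ContDiff ℝ ∞ ρ) (hU : tsupport ρ ⊆ U) :
    IsTestFun U (fun y => ρ y * f y) :=
  ⟨hρ.mul hf.1, hf.2.1.mul_left, tsupport_mul_subset_left.trans hU⟩

theorem IsTestFun.continuous_pderiv {U : Set Plane} {f : Plane → ℝ} (hf : IsTestFun U f)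
    (i : Fin 2) : Continuous (pderiv i f) :=
  (hf.1.continuous_fderiv (by simp)).clm_apply continuous_const

theorem IsTestFun.integrable_pderiv {U : Set Plane} {f : Plane → ℝ} (hf : IsTestFun U f)
    (i : Fin 2) : Integrable (pderiv i f) :=
  (hf.continuous_pderiv i).integrable_of_hasCompactSupport (hf.2.1.fderiv_apply ℝ _)

theorem IsTestFun.integral_pderiv {U : Set Plane} {f : Plane → ℝ} (hf : IsTestFun U f)
    (i : Fin 2) : ∫ y, pderiv i f y = 0 := by
  have h := integral_mul_fderiv_eq_neg_fderiv_mul_of_integrable (μ := volume)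
    (f := fun _ : Plane => (1 : ℝ)) (g := f) (v := EuclideanSpace.single i 1)
    (by simp) (by simp only [one_mul]; exact hf.integrable_pderiv i)
    (by simpa using hf.1.continuous.integrable_of_hasCompactSupport hf.2.1)
    (fun _ _ => differentiableAt_const _) (fun x _ => hf.1.differentiable (by simp) x)
  simpa [pderiv] using h

/-- A function supported away from the frontier vanishes near each frontier point, so truncating it
to `S` creates no jump. -/
theorem IsTestFun.indicator {S Γ : Set Plane} (hS : IsOpen S) (hΓ : frontier S ⊆ Γ)
    {f : Plane → ℝ} (hf : IsTestFun Γᶜ f) :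
    IsTestFun univ (S.indicator f) ∧ ∀ i, pderiv i (S.indicator f) = S.indicator (pderiv i f) := by
  have hloc : ∀ y, (y ∈ S ∧ S.indicator f =ᶠ[𝓝 y] f) ∨
      (S.indicator f =ᶠ[𝓝 y] 0 ∧ (y ∉ S ∨ f =ᶠ[𝓝 y] 0)) := fun y => by
    by_cases hy : y ∈ S
    · left
      refine ⟨hy, ?_⟩
      filter_upwards [hS.mem_nhds hy] with z hz using indicator_of_mem hz f
    · right
      refine ⟨?_, Or.inl hy⟩
      by_cases hy2 : y ∈ closure S
      · have hy3 : y ∉ tsupport f := fun h => hf.2.2 h (hΓ ⟨hy2, by rwa [hS.interior_eq]⟩)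
        filter_upwards [notMem_tsupport_iff_eventuallyEq.1 hy3] with z hz
        simp [hz]
      · filter_upwards [isClosed_closure.isOpen_compl.mem_nhds hy2] with z hz
        exact indicator_of_notMem (fun h => hz (subset_closure h)) f
  refine ⟨⟨?_, ?_, subset_univ _⟩, fun i => funext fun y => ?_⟩
  · refine contDiff_iff_contDiffAt.2 fun y => ?_
    rcases hloc y with ⟨-, h⟩ | ⟨h, -⟩
    · exact hf.1.contDiffAt.congr_of_eventuallyEq h
    · exact contDiffAt_const.congr_of_eventuallyEq h
  · exact hf.2.1.mono (by simp [support_indicator])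
  · rcases hloc y with ⟨hy, h⟩ | ⟨h, hy⟩
    · rw [indicator_of_mem hy, pderiv, h.fderiv_eq, pderiv]
    · have : pderiv i (S.indicator f) y = 0 := by rw [pderiv, h.fderiv_eq]; simp
      rw [this]
      rcases hy with hy | hy
      · rw [indicator_of_notMem hy]
      · have : pderiv i f y = 0 := by rw [pderiv, hy.fderiv_eq]; simp
        exact (indicator_apply_eq_zero.2 fun _ => this).symm

/-- Truncation to `S` yields a test function on the whole plane, whose derivatives integrate to
zero; the zero measure suffices. -/
theorem hasFluxBound_compl {S Γ : Set Plane} (hS : IsOpen S) (hΓ : frontier S ⊆ Γ) :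
    HasFluxBound S Γ Γᶜ := by
  refine ⟨0, inferInstance, ⟨0, by simp⟩, fun f hf i => ?_⟩
  obtain ⟨h1, h2⟩ := hf.indicator hS hΓ
  rw [← integral_indicator hS.measurableSet, ← h2 i, h1.integral_pderiv]
  simp

/-- Cut `f` up by a smooth partition of unity. The weights are at most 1, so the sum of the local
measures controls the total flux. -/
theorem HasFluxBound.of_cover {ι : Type*} [Fintype ι] {S Γ : Set Plane} {U : ι → Set Plane}
    (hU : ∀ j, IsOpen (U j)) (hcov : ⋃ j, U j = univ) (h : ∀ j, HasFluxBound S Γ (U j)) :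
    HasFluxBound S Γ univ := by
  choose σ hfin hle hbd using h
  choose C hC using hle
  obtain ⟨ρ, hρ⟩ := SmoothPartitionOfUnity.exists_isSubordinate
    (modelWithCornersSelf ℝ Plane) isClosed_univ U hU hcov.ge
  have hρs : ∀ j, ContDiff ℝ ∞ (ρ j) := fun j => (ρ j).contMDiff.contDiff
  refine ⟨∑ j, σ j, inferInstance, ⟨∑ j, C j, ?_⟩, fun f hf i => ?_⟩
  · rw [Finset.sum_smul]
    exact Finset.sum_le_sum fun j _ => hC j
  · have hfj : ∀ j, IsTestFun (U j) (fun y => ρ j y * f y) := fun j => hf.mul_left (hρs j) (hρ j)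
    have hsum : f = fun y => ∑ j, ρ j y * f y := funext fun y => by
      rw [← Finset.sum_mul, ← finsum_eq_sum_of_fintype, ρ.sum_eq_one (mem_univ y), one_mul]
    have hd : pderiv i f = fun y => ∑ j, pderiv i (fun y => ρ j y * f y) y := funext fun y => by
      conv_lhs => rw [hsum, pderiv]
      rw [fderiv_fun_sum fun j _ => (hfj j).1.differentiable (by simp) y]
      simp [pderiv]
    rw [hd, integral_finsetSum _ fun j _ => ((hfj j).integrable_pderiv i).integrableOn,
      lintegral_finsetSum_measure]
    refine (enorm_sum_le _ _).trans (Finset.sum_le_sum fun j _ => ((hbd j _ (hfj j) i).trans ?_))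
    refine lintegral_mono fun y => ?_
    rw [enorm_mul]
    refine mul_le_of_le_one_left zero_le ?_
    rw [← ofReal_norm, Real.norm_of_nonneg (ρ.nonneg j y)]
    exact ENNReal.ofReal_le_one.2 (ρ.le_one j y)

/-- Points on the graph are limits of points of `D` approached from above, while the region strictly
below is open and misses `D`. -/
theorem IsBoundaryChart.notMem_closure_iff {D : Set Plane} {x : Plane} {L : Plane ≃ₗᵢ[ℝ] Plane}
    {γ : ℝ → ℝ} {r : ℝ} (h : IsBoundaryChart D x L γ r) {y : Plane} (hy : y ∈ Metric.ball x r) :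
    y ∈ (closure D)ᶜ ↔ L y 1 < γ (L y 0) := by
  obtain ⟨-, hγ, hD⟩ := h
  have hγc := hγ.continuous
  constructor
  · contrapose!
    intro hle
    rw [mem_compl_iff, not_not]
    have hy0 : graphMap L γ (L y 0, L y 1 - γ (L y 0)) = y := by
      apply L.injective
      ext j; fin_cases j
      · exact apply_graphMap_zero _
      · exact (apply_graphMap_one _).trans (by simp)
    have ht : Tendsto (fun k : ℝ => graphMap L γ (L y 0, L y 1 - γ (L y 0) + k)) (𝓝[>] 0)
        (𝓝 y) := by
      have hc : Continuous (fun k : ℝ => graphMap L γ (L y 0, L y 1 - γ (L y 0) + k)) :=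
        (continuous_graphMap hγc).comp (by fun_prop)
      have := hc.tendsto 0
      rw [add_zero, hy0] at this
      exact this.mono_left nhdsWithin_le_nhds
    refine mem_closure_of_tendsto ht ?_
    filter_upwards [ht.eventually (Metric.isOpen_ball.mem_nhds hy), self_mem_nhdsWithin]
      with k hk hk0
    rw [hD _ hk, apply_graphMap_zero, apply_graphMap_one]
    have : 0 < k := hk0
    linarith
  · intro hlt hcl
    have ho : IsOpen {z | z ∈ Metric.ball x r ∧ L z 1 < γ (L z 0)} :=
      Metric.isOpen_ball.inter (isOpen_lt
        ((EuclideanSpace.proj (𝕜 := ℝ) (1 : Fin 2)).continuous.comp L.continuous)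
        (hγc.comp ((EuclideanSpace.proj (𝕜 := ℝ) (0 : Fin 2)).continuous.comp L.continuous)))
    obtain ⟨z, hz, hzD⟩ := mem_closure_iff.1 hcl _ ho ⟨hy, hlt⟩
    exact lt_asymm hz.2 ((hD z hz.1).1 hzD)

theorem HasSmoothBoundary.hasFluxBound {D : Set Plane} (hD : HasSmoothBoundary D)
    (hb : Bornology.IsBounded D) : HasFluxBound (closure D)ᶜ (frontier D) univ := by
  have hS : IsOpen (closure D)ᶜ := isClosed_closure.isOpen_compl
  choose! L γ r hchart using hD
  have hK : IsCompact (frontier D) :=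
    Metric.isCompact_of_isClosed_isBounded isClosed_frontier
      (hb.closure.subset frontier_subset_closure)
  obtain ⟨t, ht, hcov⟩ := hK.elim_nhds_subcover (fun x => Metric.ball x (r x))
    fun x hx => Metric.ball_mem_nhds x (hchart x hx).1
  -- The index `none` stands for the complement of the boundary, where no flux arises.
  refine HasFluxBound.of_cover (ι := Option t)
    (U := fun j => j.elim (frontier D)ᶜ fun x => Metric.ball x.1 (r x)) ?_ ?_ ?_
  · rintro (_ | x)
    exacts [isClosed_frontier.isOpen_compl, Metric.isOpen_ball]
  · refine eq_univ_of_forall fun y => mem_iUnion.2 ?_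
    by_cases hy : y ∈ frontier D
    · obtain ⟨x, hx, hyx⟩ := mem_iUnion₂.1 (hcov hy)
      exact ⟨some ⟨x, hx⟩, hyx⟩
    · exact ⟨none, hy⟩
  · rintro (_ | ⟨x, hx⟩)
    · refine hasFluxBound_compl hS ?_
      rw [frontier_compl]
      exact frontier_closure_subset
    · have hc := hchart x (ht x hx)
      refine hasFluxBound_of_graph hS.measurableSet hc.2.1 (fun y hy => hc.notMem_closure_iff hy)
        fun y hy hyγ => ⟨?_, fun hyi => ?_⟩
      · by_contra hn
        exact absurd ((hc.notMem_closure_iff hy).1 hn) hyγ.not_lt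
      · exact absurd ((hc.2.2 y hy).1 (interior_subset hyi)) hyγ.symm.not_lt

/-! ### Fluxes through a circle -/

theorem graphMap_mem_ball_iff {L : Plane ≃ₗᵢ[ℝ] Plane} {R : ℝ} (hR : 0 < R) (p : ℝ × ℝ) :
    graphMap L (fun _ => 0) p ∈ Metric.ball 0 R ↔ p.1 ^ 2 + p.2 ^ 2 < R ^ 2 := by
  rw [mem_ball_zero_iff, graphMap, L.symm.norm_map, ← abs_of_pos hR, ← abs_of_nonneg (norm_nonneg _),
    ← sq_lt_sq, EuclideanSpace.norm_sq_eq]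
  simp

theorem setIntegral_ball_eq (L : Plane ≃ₗᵢ[ℝ] Plane) {R : ℝ} (hR : 0 < R) {F : Plane → ℝ}
    (hF : Continuous F) (hFs : HasCompactSupport F) :
    ∫ y in Metric.ball 0 R, F y = ∫ t, ∫ h in Ioo (-√(R ^ 2 - t ^ 2)) √(R ^ 2 - t ^ 2),
      F (graphMap L (fun _ => 0) (t, h)) := by
  have hmp := measurePreserving_graphMap (L := L) (γ := fun _ => 0) continuous_const
  have hcont := continuous_graphMap (L := L) (γ := fun _ => 0) continuous_const
  have hFi : Integrable fun p => F (graphMap L (fun _ => 0) p) :=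
    (hF.comp hcont).integrable_of_hasCompactSupport
      (hasCompactSupport_comp_graphMap continuous_const hFs)
  have hmeas : MeasurableSet {p : ℝ × ℝ | p.1 ^ 2 + p.2 ^ 2 < R ^ 2} :=
    measurableSet_lt (by fun_prop) measurable_const
  have e1 : ∫ y in Metric.ball 0 R, F y =
      ∫ p in {p : ℝ × ℝ | p.1 ^ 2 + p.2 ^ 2 < R ^ 2}, F (graphMap L (fun _ => 0) p) := by
    rw [← integral_indicator measurableSet_ball, ← integral_indicator hmeas, ← hmp.map_eq,
      integral_map hmp.measurable.aemeasurable]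
    · refine integral_congr_ae (ae_of_all _ fun p => ?_)
      simp only [indicator, graphMap_mem_ball_iff hR, mem_ofPred_eq]
    · exact (hF.stronglyMeasurable.indicator measurableSet_ball).aestronglyMeasurable
  rw [e1, ← integral_indicator hmeas, Measure.volume_eq_prod,
    integral_prod _ (hFi.indicator hmeas)]
  refine integral_congr_ae (ae_of_all _ fun t => ?_)
  simp only
  rw [← integral_indicator measurableSet_Ioo]
  refine integral_congr_ae (ae_of_all _ fun h => ?_)
  have : t ^ 2 + h ^ 2 < R ^ 2 ↔ -√(R ^ 2 - t ^ 2) < h ∧ h < √(R ^ 2 - t ^ 2) := by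
    rw [← abs_lt, Real.lt_sqrt (abs_nonneg h), sq_abs]
    constructor <;> intro <;> linarith
  simp only [indicator, mem_ofPred_eq, mem_Ioo, this]

/-- The fundamental theorem of calculus on each chord. The half circles enter only as end points, so
the unbounded slope of the square root at ±R is harmless. -/
theorem setIntegral_fderiv_ball (L : Plane ≃ₗᵢ[ℝ] Plane) {R : ℝ} (hR : 0 < R) {f : Plane → ℝ}
    (hf : IsTestFun univ f) :
    ∫ y in Metric.ball 0 R, fderiv ℝ f y (L.symm (EuclideanSpace.single 1 1)) =
      ∫ t in Ioo (-R) R, (f (graphMap L (fun _ => 0) (t, √(R ^ 2 - t ^ 2))) -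
        f (graphMap L (fun _ => 0) (t, -√(R ^ 2 - t ^ 2)))) := by
  have hcont := continuous_graphMap (L := L) (γ := fun _ => 0) continuous_const
  have hFc : Continuous fun y => fderiv ℝ f y (L.symm (EuclideanSpace.single 1 1)) :=
    (hf.1.continuous_fderiv (by simp)).clm_apply continuous_const
  rw [setIntegral_ball_eq L hR hFc (hf.2.1.fderiv_apply ℝ _),
    ← integral_indicator measurableSet_Ioo]
  refine integral_congr_ae (ae_of_all _ fun t => ?_)
  have hct := (hFc.comp hcont).comp (Continuous.prodMk_right t)
  have hftc := intervalIntegral.integral_eq_sub_of_hasDerivAt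
      (fun h _ => hasDerivAt_graphMap_snd (L := L) (γ := fun _ => 0) hf.1 t h)
      (hct.intervalIntegrable (-√(R ^ 2 - t ^ 2)) √(R ^ 2 - t ^ 2))
  simp only
  rw [← integral_Ioc_eq_integral_Ioo,
    ← intervalIntegral.integral_of_le (neg_le_self (Real.sqrt_nonneg _)), hftc]
  by_cases ht : t ∈ Ioo (-R) R
  · rw [indicator_of_mem ht]
  -- For |t| ≥ R the real square root is 0 by convention, so both end points coincide and their
  -- difference vanishes.
  · rw [indicator_of_notMem ht, Real.sqrt_eq_zero_of_nonpos]
    · simp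
    · rw [mem_Ioo, ← abs_lt, not_lt] at ht
      have := sq_le_sq.2 ((abs_of_pos hR).le.trans ht)
      linarith

theorem hasFluxBound_ball {R : ℝ} (hR : 0 < R) :
    HasFluxBound (Metric.ball 0 R) (Metric.sphere 0 R) univ := by
  have hcont : ∀ L : Plane ≃ₗᵢ[ℝ] Plane, ∀ c : ℝ,
      Continuous fun t : ℝ => graphMap L (fun _ => 0) (t, c * √(R ^ 2 - t ^ 2)) := fun L c =>
    (continuous_graphMap continuous_const).comp (by fun_prop)
  set σ : (Plane ≃ₗᵢ[ℝ] Plane) → ℝ → Measure Plane := fun L c =>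
    (volume.restrict (Ioo (-R) R)).map
      fun t : ℝ => graphMap L (fun _ => 0) (t, c * √(R ^ 2 - t ^ 2)) with hσ
  have hle : ∀ L c, c ^ 2 = 1 → σ L c ≤ arcLength (Metric.sphere 0 R) := fun L c hc => by
    refine map_restrict_le_arcLength (hcont L c).measurable (p := fun y => L y 0) ?_
      (fun t _ => apply_graphMap_zero _) fun t ht => ?_
    · have := (lipschitzWith_coord 0).comp L.lipschitz
      rwa [one_mul] at this
    · have h0 : 0 ≤ R ^ 2 - t ^ 2 := by nlinarith [ht.1, ht.2]
      rw [mem_sphere_zero_iff_norm, graphMap, L.symm.norm_map, EuclideanSpace.norm_eq,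
        Real.sqrt_eq_iff_mul_self_eq (by positivity) hR.le]
      simp only [Fin.sum_univ_two, Real.norm_eq_abs, sq_abs, zero_add]
      change t ^ 2 + (c * √(R ^ 2 - t ^ 2)) ^ 2 = R * R
      rw [mul_pow, Real.sq_sqrt h0, hc]
      ring
  have hbd : ∀ L : Plane ≃ₗᵢ[ℝ] Plane, ∀ f, IsTestFun univ f →
      ‖∫ y in Metric.ball 0 R, fderiv ℝ f y (L.symm (EuclideanSpace.single 1 1))‖ₑ ≤
        ∫⁻ y, ‖f y‖ₑ ∂(σ L 1 + σ L (-1)) := fun L f hf => by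
    have hfm : Measurable fun y => ‖f y‖ₑ := hf.1.continuous.measurable.enorm
    rw [setIntegral_fderiv_ball L hR hf, lintegral_add_measure, hσ,
      lintegral_map hfm (hcont L 1).measurable, lintegral_map hfm (hcont L (-1)).measurable,
      ← lintegral_add_left (f := fun t => ‖f (graphMap L (fun _ => 0) (t, 1 * √(R ^ 2 - t ^ 2)))‖ₑ)
        (hfm.comp (hcont L 1).measurable)]
    refine (enorm_integral_le_lintegral_enorm _).trans (lintegral_mono fun t => ?_)
    simp only [one_mul, neg_one_mul]
    exact enorm_sub_le
  set L₁ : Plane ≃ₗᵢ[ℝ] Plane := LinearIsometryEquiv.refl ℝ Plane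
  -- Swapping the coordinates treats ∂₀ by chords parallel to the other axis. Two half circles for
  -- each direction give the constant 4.
  set L₀ : Plane ≃ₗᵢ[ℝ] Plane := LinearIsometryEquiv.piLpCongrLeft 2 ℝ ℝ (Equiv.swap 0 1)
  have h0 : L₀.symm (EuclideanSpace.single 1 1) = EuclideanSpace.single 0 1 := by
    rw [LinearIsometryEquiv.symm_apply_eq]
    ext j; fin_cases j <;> simp [L₀]
  refine ⟨σ L₀ 1 + σ L₀ (-1) + (σ L₁ 1 + σ L₁ (-1)), inferInstance, ⟨4, ?_⟩, fun f hf i => ?_⟩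
  · have h4 : (4 : NNReal) • arcLength (Metric.sphere 0 R) =
        arcLength (Metric.sphere 0 R) + arcLength (Metric.sphere 0 R) +
        (arcLength (Metric.sphere 0 R) + arcLength (Metric.sphere 0 R)) := by
      rw [← two_smul NNReal, ← two_smul NNReal, smul_smul]
      norm_num
    rw [h4]
    gcongr <;> exact hle _ _ (by norm_num)
  · rw [lintegral_add_measure]
    fin_cases i
    · refine le_trans ?_ le_self_add
      have := hbd L₀ f hf
      rwa [h0] at this
    · exact (hbd L₁ f hf).trans le_add_self


/-! ### Green's formula for functions with vanishing traces -/

theorem tendsto_integral_mul_of_eLpNorm {α : Type*} [MeasurableSpace α] {m : Measure α}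
    {k w : α → ℝ} (hk : MemLp k 2 m) (hw : MemLp w 2 m) {s : ℕ → α → ℝ}
    (hs : ∀ n, AEStronglyMeasurable (s n) m)
    (h : Tendsto (fun n => eLpNorm (fun x => s n x - w x) 2 m) atTop (𝓝 0)) :
    Tendsto (fun n => ∫ x, k x * s n x ∂m) atTop (𝓝 (∫ x, k x * w x ∂m)) := by
  rw [tendsto_iff_edist_tendsto_0]
  have hlim : Tendsto (fun n => eLpNorm k 2 m * eLpNorm (fun x => s n x - w x) 2 m) atTop
      (𝓝 0) := by
    simpa using ENNReal.Tendsto.const_mul h (Or.inr hk.2.ne)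
  refine tendsto_of_tendsto_of_tendsto_of_le_of_le' tendsto_const_nhds hlim
    (Eventually.of_forall fun _ => zero_le) ?_
  -- Only eventually is the error of finite norm, which puts `s n` in L² and makes the integrals
  -- split.
  filter_upwards [h.eventually (gt_mem_nhds ENNReal.zero_lt_top)] with n hn
  have hd : MemLp (fun x => s n x - w x) 2 m := ⟨(hs n).sub hw.1, hn⟩
  have hsn : MemLp (s n) 2 m := by
    convert! hd.add hw using 1
    ext; simp
  have hks : Integrable (fun x => k x * s n x) m := hk.integrable_mul hsn
  have hkw : Integrable (fun x => k x * w x) m := hk.integrable_mul hw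
  rw [edist_eq_enorm_sub, ← integral_sub hks hkw]
  calc ‖∫ x, (k x * s n x - k x * w x) ∂m‖ₑ ≤ ∫⁻ x, ‖k x * s n x - k x * w x‖ₑ ∂m :=
        enorm_integral_le_lintegral_enorm _
    _ = eLpNorm (k • fun x => s n x - w x) 1 m := by
        rw [eLpNorm_one_eq_lintegral_enorm]
        simp only [Pi.smul_apply', smul_eq_mul, mul_sub]
    _ ≤ eLpNorm k 2 m * eLpNorm (fun x => s n x - w x) 2 m :=
        eLpNorm_smul_le_mul_eLpNorm hd.1 hk.1

/-- The integral of `∂ᵢ(χ w a)` over `Ω`, for `w' = ∂ᵢw` and `a' = ∂ᵢa`. -/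
def fluxForm (Ω : Set Plane) (i : Fin 2) (χ w w' a a' : Plane → ℝ) : ℝ :=
  (∫ x in Ω, pderiv i χ x * a x * w x) + (∫ x in Ω, χ x * a x * w' x) +
    ∫ x in Ω, χ x * a' x * w x

theorem fluxForm_comm (Ω : Set Plane) (i : Fin 2) (χ w w' a a' : Plane → ℝ) :
    fluxForm Ω i χ w w' a a' = fluxForm Ω i χ a a' w w' := by
  unfold fluxForm
  rw [add_right_comm]
  congr 1
  · congr 1 <;> exact integral_congr_ae (ae_of_all _ fun x => by simp only; ring)
  · exact integral_congr_ae (ae_of_all _ fun x => by simp only; ring)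

theorem MemLp.continuous_mul {Ω : Set Plane} {k a : Plane → ℝ} (hk : Continuous k)
    (hks : HasCompactSupport k) (ha : MemLp a 2 (volume.restrict Ω)) :
    MemLp (fun x => k x * a x) 2 (volume.restrict Ω) := by
  obtain ⟨C, hC⟩ := hks.exists_bound_of_continuous hk
  exact ha.mul (memLp_top_of_bound hk.aestronglyMeasurable C (ae_of_all _ hC))

theorem tendsto_fluxForm {Ω : Set Plane} {i : Fin 2} {χ : Plane → ℝ} (hχ : IsTestFun univ χ)
    {w w' a a' : Plane → ℝ} (hw : MemLp w 2 (volume.restrict Ω))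
    (hw' : MemLp w' 2 (volume.restrict Ω)) (ha : MemLp a 2 (volume.restrict Ω))
    (ha' : MemLp a' 2 (volume.restrict Ω)) {s : ℕ → Plane → ℝ} (hs : ∀ n, ContDiff ℝ ∞ (s n))
    (h : Tendsto (fun n => eLpNorm (fun x => s n x - w x) 2 (volume.restrict Ω)) atTop (𝓝 0))
    (h' : Tendsto (fun n => eLpNorm (fun x => pderiv i (s n) x - w' x) 2 (volume.restrict Ω))
      atTop (𝓝 0)) :
    Tendsto (fun n => fluxForm Ω i χ (s n) (pderiv i (s n)) a a') atTop
      (𝓝 (fluxForm Ω i χ w w' a a')) := by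
  have hsm : ∀ n, AEStronglyMeasurable (s n) (volume.restrict Ω) := fun n =>
    (hs n).continuous.aestronglyMeasurable
  have hsm' : ∀ n, AEStronglyMeasurable (pderiv i (s n)) (volume.restrict Ω) := fun n =>
    (((hs n).continuous_fderiv (by simp)).clm_apply continuous_const).aestronglyMeasurable
  have hχc := hχ.1.continuous
  refine ((tendsto_integral_mul_of_eLpNorm ?_ hw hsm h).add
    (tendsto_integral_mul_of_eLpNorm ?_ hw' hsm' h')).add
    (tendsto_integral_mul_of_eLpNorm ?_ hw hsm h)
  · exact MemLp.continuous_mul (hχ.continuous_pderiv i) (hχ.2.1.fderiv_apply ℝ _) ha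
  · exact MemLp.continuous_mul hχc hχ.2.1 ha
  · exact MemLp.continuous_mul hχc hχ.2.1 ha'

theorem fluxForm_smooth {Ω : Set Plane} {i : Fin 2} {χ s r : Plane → ℝ} (hχ : IsTestFun univ χ)
    (hs : ContDiff ℝ ∞ s) (hr : ContDiff ℝ ∞ r) :
    fluxForm Ω i χ s (pderiv i s) r (pderiv i r) =
      ∫ x in Ω, pderiv i (fun y => χ y * (s y * r y)) x := by
  have hd : ∀ {f : Plane → ℝ}, ContDiff ℝ ∞ f → Continuous (pderiv i f) := fun hf =>
    (hf.continuous_fderiv (by simp)).clm_apply continuous_const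
  have h1 : Integrable (fun x => pderiv i χ x * r x * s x) (volume.restrict Ω) :=
    ((((hd hχ.1).mul hr.continuous).mul hs.continuous).integrable_of_hasCompactSupport
      ((hχ.2.1.fderiv_apply ℝ _).mul_right.mul_right)).integrableOn
  have h2 : Integrable (fun x => χ x * r x * pderiv i s x) (volume.restrict Ω) :=
    (((hχ.1.continuous.mul hr.continuous).mul (hd hs)).integrable_of_hasCompactSupport
      (hχ.2.1.mul_right.mul_right)).integrableOn
  have h3 : Integrable (fun x => χ x * pderiv i r x * s x) (volume.restrict Ω) :=
    (((hχ.1.continuous.mul (hd hr)).mul hs.continuous).integrable_of_hasCompactSupport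
      (hχ.2.1.mul_right.mul_right)).integrableOn
  rw [fluxForm, ← integral_add h1 h2, ← integral_add (f := fun x => pderiv i χ x * r x * s x + χ x * r x * pderiv i s x)
    (h1.add h2) h3]
  refine integral_congr_ae (ae_of_all _ fun x => ?_)
  have hdχ := hχ.1.differentiable (by simp) x
  have hds := hs.differentiable (by simp) x
  have hdr := hr.differentiable (by simp) x
  simp only [pderiv]
  rw [fderiv_fun_mul hdχ (hds.fun_mul hdr), fderiv_fun_mul hds hdr]
  simp only [add_apply, smul_apply, smul_eq_mul]
  ring

/-- Hölder's inequality with respect to the finite measure `σ`; finiteness of the arc length is not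
needed. -/
theorem lintegral_enorm_le_eLpNorm {Γ : Set Plane} {σ : Measure Plane} [IsFiniteMeasure σ]
    {C : NNReal} (hσ : σ ≤ C • arcLength Γ) :
    ∃ K : ℝ≥0∞, K ≠ ⊤ ∧ ∀ s : Plane → ℝ, Continuous s →
      ∫⁻ y, ‖s y‖ₑ ∂σ ≤ K * eLpNorm s 2 (arcLength Γ) := by
  refine ⟨(C : ℝ≥0∞) ^ (1 / (2 : ℝ≥0∞)).toReal * σ univ ^ (1 / (1 : ℝ≥0∞).toReal -
    1 / (2 : ℝ≥0∞).toReal), ENNReal.mul_ne_top ?_ ?_, fun s hs => ?_⟩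
  · exact ENNReal.rpow_ne_top_of_nonneg (by positivity) ENNReal.coe_ne_top
  · exact ENNReal.rpow_ne_top_of_nonneg (by norm_num) (measure_ne_top σ _)
  · rw [← eLpNorm_one_eq_lintegral_enorm]
    refine (eLpNorm_le_eLpNorm_mul_rpow_measure_univ (q := 2) (by norm_num)
      hs.aestronglyMeasurable).trans ?_
    rw [mul_right_comm]
    gcongr
    refine (eLpNorm_mono_measure s hσ).trans ?_
    have := eLpNorm_smul_measure_of_ne_top (p := 2) ENNReal.ofNat_ne_top s (C : ℝ≥0∞)
      (μ := arcLength Γ)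
    rw [smul_eq_mul] at this
    exact this.le

/-- On the support of `χ` the sets `S` and `Ω` agree, so only the flux through `Γ` matters. For
smooth approximations `s n` of `w` it is at most a constant times the norm of `s n` in L²(Γ), which
tends to zero. -/
theorem fluxForm_eq_zero_of_hasTrace {Ω S Γ : Set Plane} (hΩ : MeasurableSet Ω)
    (hS : MeasurableSet S) (hflux : HasFluxBound S Γ univ) {χ : Plane → ℝ}
    (hχ : IsTestFun univ χ) (hχS : ∀ y ∈ tsupport χ, y ∈ S ↔ y ∈ Ω) {w : H1 Ω}
    (hw : HasTrace Ω Γ w 0) (i : Fin 2) {r : Plane → ℝ} (hr : ContDiff ℝ ∞ r)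
    (hr2 : MemLp r 2 (volume.restrict Ω)) (hr2' : MemLp (pderiv i r) 2 (volume.restrict Ω)) :
    fluxForm Ω i χ (H1.toL2 w) (H1.partial w i) r (pderiv i r) = 0 := by
  obtain ⟨-, s, hs, hs0, hs1, hsΓ⟩ := hw
  obtain ⟨σ, hσ, ⟨C, hC⟩, hbd⟩ := hflux
  obtain ⟨K, hK, hK2⟩ := lintegral_enorm_le_eLpNorm hC
  obtain ⟨M, hM⟩ := (hχ.2.1.mul_right (f' := r)).exists_bound_of_continuous
    (hχ.1.continuous.mul hr.continuous)
  have hlim := tendsto_fluxForm hχ (Lp.memLp (H1.toL2 w)) (Lp.memLp (H1.partial w i)) hr2 hr2' hs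
    hs0 (hs1 i)
  refine tendsto_nhds_unique hlim (tendsto_iff_edist_tendsto_0.2 ?_)
  have hup : Tendsto (fun n => ‖M‖ₑ * (K * eLpNorm (fun x => s n x - (0 : Plane → ℝ) x) 2
      (arcLength Γ))) atTop (𝓝 0) := by
    have := ENNReal.Tendsto.const_mul (a := ‖M‖ₑ) (ENNReal.Tendsto.const_mul hsΓ (Or.inr hK))
      (Or.inr enorm_ne_top)
    simpa using this
  refine tendsto_of_tendsto_of_tendsto_of_le_of_le tendsto_const_nhds hup
    (fun _ => zero_le) fun n => ?_
  simp only
  rw [edist_zero_right, fluxForm_smooth hχ (hs n) hr]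
  have htest : IsTestFun univ (fun y => χ y * (s n y * r y)) :=
    ⟨hχ.1.mul ((hs n).mul hr), hχ.2.1.mul_right, subset_univ _⟩
  have hSΩ : ∫ x in Ω, pderiv i (fun y => χ y * (s n y * r y)) x =
      ∫ x in S, pderiv i (fun y => χ y * (s n y * r y)) x := by
    rw [← integral_indicator hΩ, ← integral_indicator hS]
    refine integral_congr_ae (ae_of_all _ fun y => ?_)
    by_cases hy : y ∈ tsupport χ
    · by_cases h : y ∈ Ω <;> simp [h, hχS y hy]
    · have : pderiv i (fun y => χ y * (s n y * r y)) y = 0 := by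
        rw [pderiv, image_eq_zero_of_notMem_tsupport (f := fderiv ℝ _)
          fun h => hy (tsupport_mul_subset_left (tsupport_fderiv_subset ℝ h))]
        simp
      simp only [indicator, this, ite_self]
  rw [hSΩ]
  refine (hbd _ htest i).trans ?_
  calc ∫⁻ y, ‖χ y * (s n y * r y)‖ₑ ∂σ ≤ ∫⁻ y, ‖M‖ₑ * ‖s n y‖ₑ ∂σ := by
        refine lintegral_mono fun y => ?_
        simp only
        rw [mul_left_comm, mul_comm, enorm_mul]
        gcongr
        exact enorm_le_iff_norm_le.2 ((hM y).trans (le_abs_self M))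
    _ = ‖M‖ₑ * ∫⁻ y, ‖s n y‖ₑ ∂σ := lintegral_const_mul' _ _ enorm_ne_top
    _ ≤ _ := by
        gcongr
        simpa using hK2 (s n) (hs n).continuous

theorem exists_cutoffs {K : Set Plane} (hK : IsClosed K) {R : ℝ} (hKR : K ⊆ Metric.ball 0 R) :
    ∃ χ₁ χ₂ : Plane → ℝ, IsTestFun (Metric.ball 0 R) χ₁ ∧ IsTestFun Kᶜ χ₂ ∧
      ∀ y ∈ Metric.ball 0 R, χ₁ y + χ₂ y = 1 := by
  -- The ball of radius R + 1 serves only to make the second cutoff compactly supported.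
  let U : Bool → Set Plane := fun b => bif b then Metric.ball 0 R else Kᶜ ∩ Metric.ball 0 (R + 1)
  obtain ⟨ρ, hρ⟩ := SmoothPartitionOfUnity.exists_isSubordinate
    (modelWithCornersSelf ℝ Plane) (s := Metric.closedBall (0 : Plane) R)
    Metric.isClosed_closedBall U
    (by
      rintro (_ | _)
      exacts [hK.isOpen_compl.inter Metric.isOpen_ball, Metric.isOpen_ball])
    (fun y hy => by
      by_cases hyK : y ∈ K
      · exact mem_iUnion.2 ⟨true, hKR hyK⟩
      · exact mem_iUnion.2 ⟨false, hyK, Metric.closedBall_subset_ball (by linarith) hy⟩)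
  have hsub : ∀ b, tsupport (ρ b) ⊆ Metric.ball 0 (R + 1) := by
    rintro (_ | _)
    exacts [(hρ false).trans inter_subset_right,
      (hρ true).trans (Metric.ball_subset_ball (by linarith))]
  have hc : ∀ b, HasCompactSupport (ρ b) := fun b =>
    Metric.isCompact_of_isClosed_isBounded (isClosed_tsupport _)
      (Metric.isBounded_ball.subset (hsub b))
  refine ⟨ρ true, ρ false, ⟨(ρ true).contMDiff.contDiff, hc _, hρ true⟩,
    ⟨(ρ false).contMDiff.contDiff, hc _, (hρ false).trans inter_subset_left⟩, fun y hy => ?_⟩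
  have := ρ.sum_eq_one (Metric.ball_subset_closedBall hy)
  rwa [finsum_eq_sum_of_fintype, Fintype.sum_bool] at this

theorem memLp_of_continuous_of_subset_closedBall {Ω : Set Plane} {R : ℝ}
    (hΩ : Ω ⊆ Metric.closedBall 0 R) (hΩm : MeasurableSet Ω) {f : Plane → ℝ}
    (hf : Continuous f) : MemLp f 2 (volume.restrict Ω) := by
  have : IsFiniteMeasure (volume.restrict Ω) :=
    ⟨by rw [Measure.restrict_apply_univ]
        exact (measure_mono hΩ).trans_lt measure_closedBall_lt_top⟩
  obtain ⟨C, hC⟩ := (isCompact_closedBall (0 : Plane) R).exists_bound_of_continuousOn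
    hf.continuousOn
  exact MemLp.of_bound hf.aestronglyMeasurable C
    ((ae_restrict_mem hΩm).mono fun y hy => hC y (hΩ hy))

/-- Write 1 = χ₁ + χ₂ on the disc, with χ₁ seeing only ∂D and χ₂ only the circle. On each piece one
factor has zero trace and the other may be approximated by smooth functions. In the sum the
derivatives of the cutoffs cancel. -/
theorem green_formula {D : Set Plane} (hD : HasSmoothBoundary D) (hb : Bornology.IsBounded D)
    {R : ℝ} (hR0 : 0 < R) (hR : closure D ⊆ Metric.ball 0 R) {Ω : Set Plane}
    (hΩ : Ω = annularDomain D R) {w a : H1 Ω} (hw : HasTrace Ω (frontier D) w 0)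
    (ha : HasTrace Ω (Metric.sphere 0 R) a 0) (i : Fin 2) :
    inner ℝ (H1.partial w i) (H1.toL2 a) + inner ℝ (H1.toL2 w) (H1.partial a i) = 0 := by
  have hΩm : MeasurableSet Ω := hΩ ▸ measurableSet_ball.diff isClosed_closure.measurableSet
  have hΩb : Ω ⊆ Metric.ball 0 R := hΩ ▸ sdiff_subset
  have hΩi : ∀ y, y ∈ Ω ↔ y ∈ Metric.ball 0 R ∧ y ∉ closure D := fun y => hΩ ▸ Iff.rfl
  have hmem : ∀ {f : Plane → ℝ}, Continuous f → MemLp f 2 (volume.restrict Ω) := fun hf =>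
    memLp_of_continuous_of_subset_closedBall (hΩb.trans Metric.ball_subset_closedBall) hΩm hf
  have hdc : ∀ {f : Plane → ℝ}, ContDiff ℝ ∞ f → Continuous (pderiv i f) := fun hf =>
    (hf.continuous_fderiv (by simp)).clm_apply continuous_const
  obtain ⟨χ₁, χ₂, h₁, h₂, hsum⟩ := exists_cutoffs isClosed_closure hR
  have t₁ := h₁.mono (subset_univ _)
  have t₂ := h₂.mono (subset_univ _)
  -- Near ∂D the vanishing trace is that of `w`, so `a` is the factor replaced by smooth functions.
  have z₁ : fluxForm Ω i χ₁ (H1.toL2 w) (H1.partial w i) (H1.toL2 a) (H1.partial a i) = 0 := by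
    obtain ⟨-, r, hr, hr0, hr1, -⟩ := ha
    have hlim := tendsto_fluxForm t₁ (Lp.memLp (H1.toL2 a)) (Lp.memLp (H1.partial a i))
      (Lp.memLp (H1.toL2 w)) (Lp.memLp (H1.partial w i)) hr hr0 (hr1 i)
    rw [fluxForm_comm]
    refine tendsto_nhds_unique hlim (tendsto_const_nhds.congr fun n => ?_)
    rw [fluxForm_comm]
    refine (fluxForm_eq_zero_of_hasTrace hΩm isClosed_closure.isOpen_compl.measurableSet
      (hD.hasFluxBound hb) t₁ (fun y hy => ?_) hw i (hr n) (hmem (hr n).continuous)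
      (hmem (hdc (hr n)))).symm
    exact ⟨fun h => (hΩi y).2 ⟨h₁.2.2 hy, h⟩, fun h => ((hΩi y).1 h).2⟩
  -- Near the circle the roles of `w` and `a` are exchanged.
  have z₂ : fluxForm Ω i χ₂ (H1.toL2 w) (H1.partial w i) (H1.toL2 a) (H1.partial a i) = 0 := by
    obtain ⟨-, s, hs, hs0, hs1, -⟩ := hw
    have hlim := tendsto_fluxForm t₂ (Lp.memLp (H1.toL2 w)) (Lp.memLp (H1.partial w i))
      (Lp.memLp (H1.toL2 a)) (Lp.memLp (H1.partial a i)) hs hs0 (hs1 i)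
    refine tendsto_nhds_unique hlim (tendsto_const_nhds.congr fun n => ?_)
    rw [fluxForm_comm]
    refine (fluxForm_eq_zero_of_hasTrace hΩm measurableSet_ball
      (hasFluxBound_ball hR0) t₂ (fun y hy => ?_) ha i (hs n) (hmem (hs n).continuous)
      (hmem (hdc (hs n)))).symm
    exact ⟨fun h => (hΩi y).2 ⟨h, h₂.2.2 hy⟩, fun h => ((hΩi y).1 h).1⟩
  have hdsum : ∀ y ∈ Ω, pderiv i χ₁ y + pderiv i χ₂ y = 0 := fun y hy => by
    have hev : (fun y => χ₁ y + χ₂ y) =ᶠ[𝓝 y] fun _ => 1 := by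
      filter_upwards [Metric.isOpen_ball.mem_nhds (hΩb hy)] with z hz using hsum z hz
    have := hev.fderiv_eq (𝕜 := ℝ)
    rw [fderiv_fun_add (h₁.1.differentiable (by simp) y) (h₂.1.differentiable (by simp) y)] at this
    have := congrArg (fun l => l (EuclideanSpace.single i 1)) this
    simpa [pderiv] using this
  have hi : ∀ {k u v : Plane → ℝ}, Continuous k → HasCompactSupport k →
      MemLp u 2 (volume.restrict Ω) → MemLp v 2 (volume.restrict Ω) →
      Integrable (fun x => k x * u x * v x) (volume.restrict Ω) := fun hk hks hu hv =>
    (MemLp.continuous_mul hk hks hu).integrable_mul hv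
  have m₁ := Lp.memLp (H1.toL2 w)
  have m₂ := Lp.memLp (H1.partial w i)
  have m₃ := Lp.memLp (H1.toL2 a)
  have m₄ := Lp.memLp (H1.partial a i)
  have c₁ := h₁.1.continuous
  have c₂ := h₂.1.continuous
  have hz : fluxForm Ω i χ₁ (H1.toL2 w) (H1.partial w i) (H1.toL2 a) (H1.partial a i) +
      fluxForm Ω i χ₂ (H1.toL2 w) (H1.partial w i) (H1.toL2 a) (H1.partial a i) =
      inner ℝ (H1.partial w i) (H1.toL2 a) + inner ℝ (H1.toL2 w) (H1.partial a i) := by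
    unfold fluxForm
    rw [add_add_add_comm, add_add_add_comm (∫ x in Ω, pderiv i χ₁ x * _ * _),
      ← integral_add (hi (hdc h₁.1) (h₁.2.1.fderiv_apply ℝ _) m₃ m₁)
        (hi (hdc h₂.1) (h₂.2.1.fderiv_apply ℝ _) m₃ m₁),
      ← integral_add (hi c₁ h₁.2.1 m₃ m₂) (hi c₂ h₂.2.1 m₃ m₂),
      ← integral_add (hi c₁ h₁.2.1 m₄ m₁) (hi c₂ h₂.2.1 m₄ m₁), L2.inner_def, L2.inner_def,
      setIntegral_congr_fun (g := fun _ => (0 : ℝ)) hΩm fun y hy => ?_, integral_zero, zero_add]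
    · congr 1
      · refine setIntegral_congr_fun hΩm fun y hy => ?_
        simp only [RCLike.inner_apply, conj_trivial]
        rw [← add_mul, ← add_mul, hsum y (hΩb hy), one_mul]
      · refine setIntegral_congr_fun hΩm fun y hy => ?_
        simp only [RCLike.inner_apply, conj_trivial]
        rw [← add_mul, ← add_mul, hsum y (hΩb hy), one_mul]
    · simp only
      rw [← add_mul, ← add_mul, hdsum y hy, zero_mul, zero_mul]
  rw [← hz, z₁, z₂, add_zero]


/-! ### Vanishing of the energy -/

theorem integrableOn_inner_primitive {X : Type*} [NormedAddCommGroup X] [InnerProductSpace ℝ X]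
    [CompleteSpace X] {f : ℝ → X} {t : ℝ} (hf : IntegrableOn f (Ioc 0 t)) :
    IntegrableOn (fun a => inner ℝ (∫ s in Ioc 0 a, f s) (f a)) (Ioc 0 t) := by
  have hc : ContinuousOn (fun a => ∫ s in Ioc 0 a, f s) (Icc 0 t) :=
    intervalIntegral.continuousOn_primitive (by rwa [integrableOn_Icc_iff_integrableOn_Ioc])
  obtain ⟨C, hC⟩ := isCompact_Icc.exists_bound_of_continuousOn hc
  have hm : AEStronglyMeasurable (fun a => ∫ s in Ioc 0 a, f s) (volume.restrict (Ioc 0 t)) :=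
    (hc.mono Ioc_subset_Icc_self).aestronglyMeasurable measurableSet_Ioc
  refine Integrable.mono' (hf.norm.const_mul C) (hm.inner hf.1) ?_
  filter_upwards [ae_restrict_mem measurableSet_Ioc] with a ha
  exact (norm_inner_le_norm _ _).trans (by gcongr; exact hC a (Ioc_subset_Icc_self ha))

theorem ae_eq_zero_of_energy {X : Type*} [NormedAddCommGroup X] [InnerProductSpace ℝ X]
    [CompleteSpace X] {T k l : ℝ} (hk : 0 < k) (hl : 0 < l) {p p₁ p₂ q q₁ q₂ U V : ℝ → X}
    (ip₁ : IntegrableOn p₁ (Ioo 0 T)) (ip₂ : IntegrableOn p₂ (Ioo 0 T))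
    (iq₁ : IntegrableOn q₁ (Ioo 0 T)) (iq₂ : IntegrableOn q₂ (Ioo 0 T))
    (iU : IntegrableOn U (Ioo 0 T)) (iV : IntegrableOn V (Ioo 0 T))
    (hp : ∀ᵐ t ∂volume.restrict (Ioo 0 T), p t = ∫ s in Ioc 0 t, p₁ s)
    (hp₁ : ∀ᵐ t ∂volume.restrict (Ioo 0 T), p₁ t = ∫ s in Ioc 0 t, p₂ s)
    (hq : ∀ᵐ t ∂volume.restrict (Ioo 0 T), q t = ∫ s in Ioc 0 t, q₁ s)
    (hq₁ : ∀ᵐ t ∂volume.restrict (Ioo 0 T), q₁ t = ∫ s in Ioc 0 t, q₂ s)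
    (h : ∀ᵐ t ∂volume.restrict (Ioo 0 T), ∀ᵐ s ∂volume.restrict (Ioo 0 T),
      k * inner ℝ (p₂ s) (p t) + l * inner ℝ (q₂ s) (q t) + inner ℝ (U s) (U t) +
        inner ℝ (V s) (V t) = 0) :
    ∀ᵐ t ∂volume.restrict (Ioo 0 T), p t = 0 ∧ q t = 0 := by
  have hsub : ∀ {t}, t < T → Ioc 0 t ⊆ Ioo 0 T := fun ht x hx => ⟨hx.1, hx.2.trans_lt ht⟩
  have key : ∀ᵐ t ∂volume.restrict (Ioo 0 T),
      k * inner ℝ (∫ s in Ioc 0 t, p₁ s) (p₁ t) + l * inner ℝ (∫ s in Ioc 0 t, q₁ s) (q₁ t) +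
        inner ℝ (∫ s in Ioc 0 t, U s) (U t) + inner ℝ (∫ s in Ioc 0 t, V s) (V t) = 0 := by
    filter_upwards [h, hp, hp₁, hq, hq₁, ae_restrict_mem measurableSet_Ioo]
      with t ht e1 e2 e3 e4 htT
    have hs := hsub htT.2
    have hint : ∀ {f : ℝ → X}, IntegrableOn f (Ioo 0 T) → ∀ y : X,
        IntegrableOn (fun s => inner ℝ (f s) y) (Ioc 0 t) ∧
        ∫ s in Ioc 0 t, inner ℝ (f s) y = inner ℝ (∫ s in Ioc 0 t, f s) y := fun {f} hf y => by
      have hf' : IntegrableOn f (Ioc 0 t) := hf.mono_set hs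
      refine ⟨hf'.inner_const y, ?_⟩
      rw [real_inner_comm, ← integral_inner hf']
      exact integral_congr_ae (ae_of_all _ fun s => real_inner_comm _ _)
    -- First integration, in s with t fixed: it turns `p₂`, `q₂` into `p₁ t`, `q₁ t`.
    have h0 : ∫ s in Ioc 0 t, (k * inner ℝ (p₂ s) (p t) + l * inner ℝ (q₂ s) (q t) +
        inner ℝ (U s) (U t) + inner ℝ (V s) (V t)) = 0 :=
      (integral_congr_ae (ae_restrict_of_ae_restrict_of_subset hs ht)).trans (integral_zero _ _)
    have i1 := (hint ip₂ (p t)).1.const_mul k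
    have i2 := (hint iq₂ (q t)).1.const_mul l
    have i3 := (hint iU (U t)).1
    have i4 := (hint iV (V t)).1
    rw [integral_add (f := fun s => k * inner ℝ (p₂ s) (p t) + l * inner ℝ (q₂ s) (q t) +
        inner ℝ (U s) (U t)) ((i1.add i2).add i3) i4,
      integral_add (f := fun s => k * inner ℝ (p₂ s) (p t) + l * inner ℝ (q₂ s) (q t))
        (i1.add i2) i3, integral_add i1 i2, integral_const_mul, integral_const_mul,
      (hint ip₂ _).2, (hint iq₂ _).2, (hint iU _).2, (hint iV _).2, ← e2, ← e4] at h0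
    rw [← e1, ← e3, real_inner_comm, real_inner_comm (q₁ t)]
    exact h0
  filter_upwards [hp, hq, ae_restrict_mem measurableSet_Ioo] with t e1 e2 htT
  have hs := hsub htT.2
  have j1 := (integrableOn_inner_primitive (ip₁.mono_set hs)).const_mul k
  have j2 := (integrableOn_inner_primitive (iq₁.mono_set hs)).const_mul l
  have j3 := integrableOn_inner_primitive (iU.mono_set hs)
  have j4 := integrableOn_inner_primitive (iV.mono_set hs)
  -- Second integration: by `norm_sq_primitive` each term becomes half of a squared norm.
  have h0 : ∫ a in Ioc 0 t, (k * inner ℝ (∫ s in Ioc 0 a, p₁ s) (p₁ a) +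
      l * inner ℝ (∫ s in Ioc 0 a, q₁ s) (q₁ a) +
        inner ℝ (∫ s in Ioc 0 a, U s) (U a) + inner ℝ (∫ s in Ioc 0 a, V s) (V a)) = 0 :=
    (integral_congr_ae (ae_restrict_of_ae_restrict_of_subset hs key)).trans (integral_zero _ _)
  rw [integral_add (f := fun a => k * inner ℝ (∫ s in Ioc 0 a, p₁ s) (p₁ a) +
        l * inner ℝ (∫ s in Ioc 0 a, q₁ s) (q₁ a) + inner ℝ (∫ s in Ioc 0 a, U s) (U a))
        ((j1.add j2).add j3) j4,
    integral_add (f := fun a => k * inner ℝ (∫ s in Ioc 0 a, p₁ s) (p₁ a) +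
        l * inner ℝ (∫ s in Ioc 0 a, q₁ s) (q₁ a)) (j1.add j2) j3,
    integral_add j1 j2, integral_const_mul, integral_const_mul] at h0
  have n1 := norm_sq_primitive (ip₁.mono_set hs)
  have n2 := norm_sq_primitive (iq₁.mono_set hs)
  have n3 := norm_sq_primitive (iU.mono_set hs)
  have n4 := norm_sq_primitive (iV.mono_set hs)
  rw [← e1] at n1
  rw [← e2] at n2
  have hsum : k * ‖p t‖ ^ 2 + l * ‖q t‖ ^ 2 + ‖∫ s in Ioc 0 t, U s‖ ^ 2 +
      ‖∫ s in Ioc 0 t, V s‖ ^ 2 = 0 := by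
    rw [← n1, ← n2, ← n3, ← n4]
    linear_combination 2 * h0
  have hp0 : k * ‖p t‖ ^ 2 = 0 := by
    have : 0 ≤ k * ‖p t‖ ^ 2 := by positivity
    have : 0 ≤ l * ‖q t‖ ^ 2 := by positivity
    nlinarith [sq_nonneg ‖∫ s in Ioc 0 t, U s‖, sq_nonneg ‖∫ s in Ioc 0 t, V s‖]
  have hq0 : l * ‖q t‖ ^ 2 = 0 := by
    have : 0 ≤ l * ‖q t‖ ^ 2 := by positivity
    nlinarith [sq_nonneg ‖∫ s in Ioc 0 t, U s‖, sq_nonneg ‖∫ s in Ioc 0 t, V s‖]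
  simpa [hk.ne', hl.ne'] using And.intro hp0 hq0

/-! ### Weak derivatives -/

theorem L2.eq_of_forall_integral_mul {Ω : Set Plane} (hΩ : IsOpen Ω) {g h : L2 Ω}
    (H : ∀ η, IsTestFun Ω η → ∫ x in Ω, g x * η x = ∫ x in Ω, h x * η x) : g = h := by
  have hg := Lp.memLp g
  have hh := Lp.memLp h
  have h0 : ∀ᵐ x ∂volume.restrict Ω, x ∈ Ω → g x - h x = 0 := by
    refine hΩ.ae_eq_zero_of_integral_contDiff_smul_eq_zero
      (((hg.sub hh).locallyIntegrable one_le_two).locallyIntegrableOn Ω) fun η h1 h2 h3 => ?_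
    have hη : IsTestFun Ω η := ⟨h1, h2, h3⟩
    have e1 : Integrable (fun x => g x * η x) (volume.restrict Ω) := hg.integrable_mul hη.memLp
    have e2 : Integrable (fun x => h x * η x) (volume.restrict Ω) := hh.integrable_mul hη.memLp
    rw [← sub_eq_zero.2 (H η hη), ← integral_sub e1 e2]
    exact integral_congr_ae (ae_of_all _ fun x => by simp only [smul_eq_mul]; ring)
  refine Lp.ext ?_
  filter_upwards [h0, ae_restrict_mem hΩ.measurableSet] with x hx hxΩ
  exact sub_eq_zero.1 (hx hxΩ)

theorem IsWeakPartial.unique {Ω : Set Plane} (hΩ : IsOpen Ω) {i : Fin 2} {u g h : L2 Ω}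
    (hg : IsWeakPartial Ω i u g) (hh : IsWeakPartial Ω i u h) : g = h :=
  L2.eq_of_forall_integral_mul hΩ fun η hη => neg_injective ((hg η hη).symm.trans (hh η hη))

theorem IsTestFun.pderiv {Ω : Set Plane} {η : Plane → ℝ} (h : IsTestFun Ω η) (i : Fin 2) :
    IsTestFun Ω (pderiv i η) := by
  refine ⟨?_, h.2.1.fderiv_apply ℝ _, (tsupport_fderiv_apply_subset ℝ _).trans h.2.2⟩
  exact (h.1.fderiv_right (by simp)).clm_apply contDiff_const

theorem pderiv_pderiv {f : Plane → ℝ} (hf : ContDiff ℝ ∞ f) (i j : Fin 2) :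
    pderiv i (pderiv j f) = pderiv j (pderiv i f) := by
  have hd : Differentiable ℝ (fderiv ℝ f) :=
    (hf.fderiv_right (m := ∞) (by simp)).differentiable (by simp)
  have e : ∀ i j x, pderiv i (pderiv j f) x = fderiv ℝ (fderiv ℝ f) x
      (EuclideanSpace.single i 1) (EuclideanSpace.single j 1) := fun i j x => by
    unfold pderiv
    rw [fderiv_clm_apply (hd x) (differentiableAt_const _)]
    simp
  funext x
  rw [e, e]
  refine (hf.contDiffAt.isSymmSndFDerivAt ?_) _ _
  rw [minSmoothness_of_isRCLikeNormedField]
  exact ENat.LEInfty.out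

/-- Moving both derivatives onto the test function reduces this to the symmetry of its second
derivatives. -/
theorem H2.partial_partial_comm {Ω : Set Plane} (hΩ : IsOpen Ω) (u : H2 Ω) (i j : Fin 2) :
    H1.partial (H2.partial u i) j = H1.partial (H2.partial u j) i := by
  have e : ∀ i j η, IsTestFun Ω η → ∫ x in Ω, H1.partial (H2.partial u i) j x * η x =
      ∫ x in Ω, H2.toL2 u x * pderiv i (pderiv j η) x := fun i j η hη => by
    have h1 := u.2.2 i j η hη
    have h2 := u.2.1 i _ (hη.pderiv j)
    rw [h1, neg_neg] at h2
    exact h2.symm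
  refine L2.eq_of_forall_integral_mul hΩ fun η hη => ?_
  rw [e i j η hη, e j i η hη, pderiv_pderiv hη.1]

/-- An element of `H2 Ω` is a tuple, so its derivative entries must be shown to vanish too, by
uniqueness of weak derivatives. -/
theorem H2.eq_zero_of_toL2_eq_zero {Ω : Set Plane} (hΩ : IsOpen Ω) {u : H2 Ω}
    (hu : H2.toL2 u = 0) : u = 0 := by
  have h1 : ∀ i, u.1 (.inr (.inl i)) = 0 := fun i => by
    have := u.2.1 i
    rw [show u.1 (.inl ()) = 0 from hu] at this
    exact this.unique hΩ IsWeakPartial.zero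
  have h2 : ∀ i j, u.1 (.inr (.inr (i, j))) = 0 := fun i j => by
    have := u.2.2 i j
    rw [h1 i] at this
    exact this.unique hΩ IsWeakPartial.zero
  apply Subtype.ext
  ext1 a
  rcases a with _ | i | ⟨i, j⟩
  exacts [hu, h1 i, h2 i j]

/-! ### Linearity of traces -/

theorem tendsto_eLpNorm_add_smul {α : Type*} [MeasurableSpace α] {m : Measure α}
    {s s' : ℕ → α → ℝ} {g g' k : α → ℝ} (c : ℝ) (hs : ∀ n, AEStronglyMeasurable (s n) m)
    (hs' : ∀ n, AEStronglyMeasurable (s' n) m) (hg : AEStronglyMeasurable g m)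
    (hg' : AEStronglyMeasurable g' m) (hk : k =ᵐ[m] fun x => g x + c * g' x)
    (h : Tendsto (fun n => eLpNorm (fun x => s n x - g x) 2 m) atTop (𝓝 0))
    (h' : Tendsto (fun n => eLpNorm (fun x => s' n x - g' x) 2 m) atTop (𝓝 0)) :
    Tendsto (fun n => eLpNorm (fun x => s n x + c * s' n x - k x) 2 m) atTop (𝓝 0) := by
  have hlim := h.add (ENNReal.Tendsto.const_mul (a := ‖c‖ₑ) h' (Or.inr enorm_ne_top))
  rw [mul_zero, add_zero] at hlim
  refine tendsto_of_tendsto_of_tendsto_of_le_of_le tendsto_const_nhds hlim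
    (fun _ => zero_le) fun n => ?_
  calc eLpNorm (fun x => s n x + c * s' n x - k x) 2 m
      = eLpNorm ((fun x => s n x - g x) + c • fun x => s' n x - g' x) 2 m := by
        refine eLpNorm_congr_ae ?_
        filter_upwards [hk] with x hx
        simp only [hx, Pi.add_apply, Pi.smul_apply, smul_eq_mul]
        ring
    _ ≤ _ := by
        refine (eLpNorm_add_le ((hs n).sub hg) (((hs' n).sub hg').const_smul c)
          one_le_two).trans ?_
        rw [eLpNorm_const_smul]
        exact le_rfl

/-- The coefficient covers both differences of solutions and the two displacement components, with c
= ±1. -/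
theorem HasTrace.add_smul {Ω Γ : Set Plane} {w w' : H1 Ω} {g g' : Plane → ℝ} (c : ℝ)
    (h : HasTrace Ω Γ w g) (h' : HasTrace Ω Γ w' g') :
    HasTrace Ω Γ (w + c • w') (fun x => g x + c * g' x) := by
  obtain ⟨hg, s, hs, h0, h1, h2⟩ := h
  obtain ⟨hg', s', hs', h0', h1', h2'⟩ := h'
  have hk : ∀ u u' : L2 Ω, (↑(u + c • u') : Plane → ℝ) =ᵐ[volume.restrict Ω]
      fun x => u x + c * u' x := fun u u' => by
    filter_upwards [Lp.coeFn_add u (c • u'), Lp.coeFn_smul c u'] with x hx hx'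
    rw [hx, Pi.add_apply, hx', Pi.smul_apply, smul_eq_mul]
  have hm : ∀ {f : Plane → ℝ}, ContDiff ℝ ∞ f → ∀ m : Measure Plane, AEStronglyMeasurable f m :=
    fun hf m => hf.continuous.aestronglyMeasurable
  have hm' : ∀ {f : Plane → ℝ}, ContDiff ℝ ∞ f → ∀ i, ∀ m : Measure Plane,
      AEStronglyMeasurable (pderiv i f) m := fun hf i m =>
    ((hf.continuous_fderiv (by simp)).clm_apply continuous_const).aestronglyMeasurable
  refine ⟨hg.add (hg'.const_smul c), fun n x => s n x + c * s' n x,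
    fun n => (hs n).add (contDiff_const.mul (hs' n)), ?_, fun i => ?_, ?_⟩
  · exact tendsto_eLpNorm_add_smul c (fun n => hm (hs n) _) (fun n => hm (hs' n) _)
      (Lp.aestronglyMeasurable _) (Lp.aestronglyMeasurable _) (hk _ _) h0 h0'
  · have e : ∀ n, pderiv i (fun x => s n x + c * s' n x) =
        fun x => pderiv i (s n) x + c * pderiv i (s' n) x := fun n => funext fun x => by
      have d := (hs n).differentiable (by simp) x
      have d' := (hs' n).differentiable (by simp) x
      simp only [pderiv]
      rw [fderiv_fun_add d (d'.const_mul c), fderiv_const_mul d']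
      simp
    simp only [e]
    exact tendsto_eLpNorm_add_smul c (fun n => hm' (hs n) i _) (fun n => hm' (hs' n) i _)
      (Lp.aestronglyMeasurable _) (Lp.aestronglyMeasurable _) (hk _ _) (h1 i) (h1' i)
  · exact tendsto_eLpNorm_add_smul c (fun n => hm (hs n) _) (fun n => hm (hs' n) _)
      hg.1 hg'.1 EventuallyEq.rfl h2 h2'

theorem HasTrace.congr_ae {Ω Γ : Set Plane} {w : H1 Ω} {g g' : Plane → ℝ}
    (h : HasTrace Ω Γ w g) (hg : g =ᵐ[arcLength Γ] g') : HasTrace Ω Γ w g' := by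
  obtain ⟨hm, s, hs, h0, h1, h2⟩ := h
  refine ⟨hm.ae_eq hg, s, hs, h0, h1, h2.congr fun n => eLpNorm_congr_ae ?_⟩
  filter_upwards [hg] with x hx
  rw [hx]

/-! ### The normal vector -/

/-- A chart supplies a witness, so the chosen vector is an outer unit normal of some chart. Only its
length is used below, not its uniqueness. -/
theorem outerNormal_sq_add_sq {D : Set Plane} (hD : HasSmoothBoundary D) {x : Plane}
    (hx : x ∈ frontier D) : outerNormal D x 0 ^ 2 + outerNormal D x 1 ^ 2 = 1 := by
  have hex : ∃ n, IsOuterUnitNormal D x n := by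
    obtain ⟨L, γ, r, h⟩ := hD x hx
    exact ⟨L.symm ((√(1 + deriv γ (L x 0) ^ 2))⁻¹ • !₂[deriv γ (L x 0), -1]), L, γ, r, h,
      L.apply_symm_apply _⟩
  obtain ⟨L, γ, r, -, h⟩ := Classical.epsilon_spec hex
  change L (outerNormal D x) = _ at h
  have h2 : ‖outerNormal D x‖ ^ 2 = 1 := by
    have hpos : 0 < 1 + deriv γ (L x 0) ^ 2 := by positivity
    rw [← L.norm_map, h, norm_smul, mul_pow, EuclideanSpace.norm_sq_eq, Real.norm_eq_abs, sq_abs,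
      inv_pow, Real.sq_sqrt hpos.le]
    simp only [Fin.sum_univ_two, Real.norm_eq_abs, sq_abs]
    change _ * (deriv γ (L x 0) ^ 2 + (-1) ^ 2) = 1
    field_simp
    ring
  simpa [EuclideanSpace.norm_sq_eq] using h2

/-! ### Differences of solutions -/

/-- The components of an element of `H²(Ω)` as continuous linear maps. -/
def H2.component (Ω : Set Plane) (a : Unit ⊕ Fin 2 ⊕ (Fin 2 × Fin 2)) : H2 Ω →L[ℝ] L2 Ω :=
  (PiLp.proj 2 (fun _ : Unit ⊕ Fin 2 ⊕ (Fin 2 × Fin 2) => L2 Ω) a).comp (H2 Ω).subtypeL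

theorem L2Time.integrableOn {T : ℝ} {X : Type*} [NormedAddCommGroup X] (u : L2Time T X) :
    IntegrableOn u (Ioo 0 T) :=
  (Lp.memLp u).integrable one_le_two

theorem L2Time.integrableOn_component {Ω : Set Plane} {T : ℝ} (u : L2Time T (H2 Ω))
    (a : Unit ⊕ Fin 2 ⊕ (Fin 2 × Fin 2)) :
    IntegrableOn (fun t => H2.component Ω a (u t)) (Ioo 0 T) :=
  (H2.component Ω a).integrable_comp (L2Time.integrableOn u)

theorem HasWeakTimeDeriv.sub {X : Type*} [NormedAddCommGroup X] [NormedSpace ℝ X] {T : ℝ}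
    {u w u' w' v z : ℝ → X} (iu : IntegrableOn u (Ioo 0 T)) (iw : IntegrableOn w (Ioo 0 T))
    (iu' : IntegrableOn u' (Ioo 0 T)) (iw' : IntegrableOn w' (Ioo 0 T))
    (h : HasWeakTimeDeriv T u w) (h' : HasWeakTimeDeriv T u' w')
    (hv : v =ᵐ[volume.restrict (Ioo 0 T)] fun t => u t - u' t)
    (hz : z =ᵐ[volume.restrict (Ioo 0 T)] fun t => w t - w' t) : HasWeakTimeDeriv T v z := by
  intro η hη
  have hc : Continuous (deriv η) := hη.1.continuous_deriv (by simp)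
  have hi : ∀ {k : ℝ → ℝ} {f : ℝ → X}, Continuous k → HasCompactSupport k →
      IntegrableOn f (Ioo 0 T) → IntegrableOn (fun t => k t • f t) (Ioo 0 T) :=
    fun {k f} hk hks hf => by
      obtain ⟨C, hC⟩ := hks.exists_bound_of_continuous hk
      exact Integrable.bdd_smul hf C hk.aestronglyMeasurable (ae_of_all _ hC)
  have e1 : ∫ t in Ioo 0 T, deriv η t • v t =
      ∫ t in Ioo 0 T, (deriv η t • u t - deriv η t • u' t) :=
    integral_congr_ae (hv.mono fun t ht => by simp only [ht, smul_sub])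
  have e2 : ∫ t in Ioo 0 T, η t • z t = ∫ t in Ioo 0 T, (η t • w t - η t • w' t) :=
    integral_congr_ae (hz.mono fun t ht => by simp only [ht, smul_sub])
  rw [e1, e2, integral_sub (hi hc hη.2.1.deriv iu) (hi hc hη.2.1.deriv iu'),
    integral_sub (hi hη.1.continuous hη.2.1 iw) (hi hη.1.continuous hη.2.1 iw'), h η hη, h' η hη]
  abel

theorem HasInitialValue.sub {X : Type*} [NormedAddCommGroup X] {T : ℝ} {u u' v : ℝ → X} {a a' : X}
    (h : HasInitialValue T u a) (h' : HasInitialValue T u' a')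
    (hv : v =ᵐ[volume.restrict (Ioo 0 T)] fun t => u t - u' t) :
    HasInitialValue T v (a - a') := by
  obtain ⟨f, hf, huf, rfl⟩ := h
  obtain ⟨f', hf', huf', rfl⟩ := h'
  refine ⟨fun t => f t - f' t, hf.sub hf', ?_, rfl⟩
  filter_upwards [hv, huf, huf'] with t h1 h2 h3
  rw [h1, h2, h3]

theorem SolvesWave.sub {Ω : Set Plane} {T c : ℝ} {φ φ' : L2Time T (H2 Ω)}
    (h : SolvesWave Ω T c φ) (h' : SolvesWave Ω T c φ') : SolvesWave Ω T c (φ - φ') := by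
  obtain ⟨φ₁, φ₂, h1, h2, h3, h4, h5⟩ := h
  obtain ⟨φ₁', φ₂', h1', h2', h3', h4', h5'⟩ := h'
  have e0 : (fun t => H2.toL2 ((φ - φ') t)) =ᵐ[volume.restrict (Ioo 0 T)]
      fun t => H2.toL2 (φ t) - H2.toL2 (φ' t) := by
    filter_upwards [Lp.coeFn_sub φ φ'] with t ht
    rw [ht]
    rfl
  have e1 := Lp.coeFn_sub φ₁ φ₁'
  have e2 := Lp.coeFn_sub φ₂ φ₂'
  refine ⟨φ₁ - φ₁', φ₂ - φ₂', ?_, ?_, ?_, ?_, ?_⟩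
  · exact HasWeakTimeDeriv.sub (L2Time.integrableOn_component φ (.inl ())) φ₁.integrableOn
      (L2Time.integrableOn_component φ' (.inl ())) φ₁'.integrableOn h1 h1' e0 e1
  · exact HasWeakTimeDeriv.sub φ₁.integrableOn φ₂.integrableOn φ₁'.integrableOn φ₂'.integrableOn
      h2 h2' e1 e2
  · filter_upwards [h3, h3', e2, Lp.coeFn_sub φ φ'] with t k k' k2 k0
    have hl : H2.laplacian (φ t - φ' t) = H2.laplacian (φ t) - H2.laplacian (φ' t) := by
      unfold H2.laplacian
      rw [← Finset.sum_sub_distrib]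
      rfl
    rw [k2, k0, Pi.sub_apply, Pi.sub_apply, hl, smul_sub, sub_sub_sub_comm, k, k', sub_zero]
  · simpa using h4.sub h4' e0
  · simpa using h5.sub h5' e1

theorem H1.sub_eq {Ω : Set Plane} (u v : H1 Ω) : u - v = u + (-1 : ℝ) • v := by
  rw [neg_one_smul, sub_eq_add_neg]

theorem IsCoupledSolution.sub {D : Set Plane} {R T c₁ c₂ : ℝ} {f₁ f₂ : ℝ → Plane → ℝ}
    {φ ψ φ' ψ' : L2Time T (H2 (annularDomain D R))}
    (h : IsCoupledSolution D R T c₁ c₂ f₁ f₂ φ ψ)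
    (h' : IsCoupledSolution D R T c₁ c₂ f₁ f₂ φ' ψ') :
    IsCoupledSolution D R T c₁ c₂ 0 0 (φ - φ') (ψ - ψ') := by
  refine ⟨h.wave_φ.sub h'.wave_φ, h.wave_ψ.sub h'.wave_ψ, ?_, ?_⟩
  · filter_upwards [h.coupled, h'.coupled, Lp.coeFn_sub φ φ', Lp.coeFn_sub ψ ψ']
      with t ⟨G, H, hG, hH, hx⟩ ⟨G', H', hG', hH', hx'⟩ eφ eψ
    rw [eφ, eψ]
    refine ⟨fun x => G x - G' x, fun x => H x - H' x, fun i => ?_, fun i => ?_, ?_⟩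
    · have := (hG i).add_smul (-1) (hG' i)
      rw [← H1.sub_eq] at this
      exact this.congr_ae (ae_of_all _ fun x => by simp; ring)
    · have := (hH i).add_smul (-1) (hH' i)
      rw [← H1.sub_eq] at this
      exact this.congr_ae (ae_of_all _ fun x => by simp; ring)
    · filter_upwards [hx, hx'] with x ⟨k1, k2⟩ ⟨k1', k2'⟩
      simp only [inner_sub_right, Pi.zero_apply]
      constructor <;> linarith
  · filter_upwards [h.outer, h'.outer, Lp.coeFn_sub φ φ', Lp.coeFn_sub ψ ψ']
      with t ⟨k1, k2⟩ ⟨k1', k2'⟩ eφ eψ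
    rw [eφ, eψ]
    constructor
    · have := k1.add_smul (-1) k1'
      rw [← H1.sub_eq] at this
      exact this.congr_ae (ae_of_all _ fun x => by simp)
    · have := k2.add_smul (-1) k2'
      rw [← H1.sub_eq] at this
      exact this.congr_ae (ae_of_all _ fun x => by simp)

/-! ### Uniqueness -/

/-- The displacement field of the potentials `φ` and `ψ` has vanishing trace if its normal and
tangential components do. -/
theorem hasTrace_displacement {D Ω : Set Plane} (hD : HasSmoothBoundary D) {u v : H2 Ω}
    {G H : Plane → Plane} (hG : HasGradientTrace Ω (frontier D) u G)
    (hH : HasGradientTrace Ω (frontier D) v H)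
    (h : ∀ᵐ x ∂arcLength (frontier D),
      inner ℝ (outerNormal D x) (G x) + inner ℝ (tangent D x) (H x) = 0 ∧
      inner ℝ (tangent D x) (G x) - inner ℝ (outerNormal D x) (H x) = 0) :
    HasTrace Ω (frontier D) (H2.partial u 0 + (1 : ℝ) • H2.partial v 1) 0 ∧
    HasTrace Ω (frontier D) (H2.partial u 1 + (-1 : ℝ) • H2.partial v 0) 0 := by
  have hae : ∀ᵐ x ∂arcLength (frontier D),
      G x 0 + 1 * H x 1 = 0 ∧ G x 1 + (-1) * H x 0 = 0 := by
    filter_upwards [h, ae_restrict_mem isClosed_frontier.measurableSet] with x ⟨h1, h2⟩ hx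
    have hn := outerNormal_sq_add_sq hD hx
    simp only [tangent, PiLp.inner_apply, Fin.sum_univ_two, RCLike.inner_apply, conj_trivial] at h1 h2
    change G x 0 * outerNormal D x 0 + G x 1 * outerNormal D x 1 +
      (H x 0 * -outerNormal D x 1 + H x 1 * outerNormal D x 0) = 0 at h1
    change G x 0 * -outerNormal D x 1 + G x 1 * outerNormal D x 0 -
      (H x 0 * outerNormal D x 0 + H x 1 * outerNormal D x 1) = 0 at h2
    constructor
    -- Rotates the vanishing components along (ν, τ) back to Cartesian ones, using |ν| = 1.
    · linear_combination outerNormal D x 0 * h1 - outerNormal D x 1 * h2 -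
        (G x 0 + H x 1) * hn
    · linear_combination outerNormal D x 1 * h1 + outerNormal D x 0 * h2 -
        (G x 1 - H x 0) * hn
  exact ⟨((hG 0).add_smul 1 (hH 1)).congr_ae (hae.mono fun x hx => hx.1),
    ((hG 1).add_smul (-1) (hH 0)).congr_ae (hae.mono fun x hx => hx.2)⟩

/-- Green's formula for the coupled system. -/
theorem inner_laplacian_add_inner_laplacian {D : Set Plane} (hD : HasSmoothBoundary D)
    (hb : Bornology.IsBounded D) {R : ℝ} (hR0 : 0 < R) (hR : closure D ⊆ Metric.ball 0 R)
    {u v u' v' : H2 (annularDomain D R)}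
    (h0 : HasTrace (annularDomain D R) (frontier D)
      (H2.partial u 0 + (1 : ℝ) • H2.partial v 1) 0)
    (h1 : HasTrace (annularDomain D R) (frontier D)
      (H2.partial u 1 + (-1 : ℝ) • H2.partial v 0) 0)
    (hu' : HasTrace (annularDomain D R) (Metric.sphere 0 R) (H2.toH1 u') 0)
    (hv' : HasTrace (annularDomain D R) (Metric.sphere 0 R) (H2.toH1 v') 0) :
    inner ℝ (H2.laplacian u) (H2.toL2 u') + inner ℝ (H2.laplacian v) (H2.toL2 v') +
      inner ℝ (H1.toL2 (H2.partial u 0) + (1 : ℝ) • H1.toL2 (H2.partial v 1))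
        (H1.toL2 (H2.partial u' 0) + (1 : ℝ) • H1.toL2 (H2.partial v' 1)) +
      inner ℝ (H1.toL2 (H2.partial u 1) + (-1 : ℝ) • H1.toL2 (H2.partial v 0))
        (H1.toL2 (H2.partial u' 1) + (-1 : ℝ) • H1.toL2 (H2.partial v' 0)) = 0 := by
  have hΩ : IsOpen (annularDomain D R) := Metric.isOpen_ball.sdiff isClosed_closure
  -- `g1` + `g2` tests the divergence of the displacement against `u'`; `g3` - `g4` tests its curl
  -- against `v'`.
  have g1 : inner ℝ (H1.partial (H2.partial u 0) 0 + (1 : ℝ) • H1.partial (H2.partial v 1) 0)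
      (H2.toL2 u') + inner ℝ (H1.toL2 (H2.partial u 0) + (1 : ℝ) • H1.toL2 (H2.partial v 1))
      (H1.toL2 (H2.partial u' 0)) = 0 := green_formula hD hb hR0 hR rfl h0 hu' 0
  have g2 : inner ℝ (H1.partial (H2.partial u 1) 1 + (-1 : ℝ) • H1.partial (H2.partial v 0) 1)
      (H2.toL2 u') + inner ℝ (H1.toL2 (H2.partial u 1) + (-1 : ℝ) • H1.toL2 (H2.partial v 0))
      (H1.toL2 (H2.partial u' 1)) = 0 := green_formula hD hb hR0 hR rfl h1 hu' 1
  have g3 : inner ℝ (H1.partial (H2.partial u 0) 1 + (1 : ℝ) • H1.partial (H2.partial v 1) 1)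
      (H2.toL2 v') + inner ℝ (H1.toL2 (H2.partial u 0) + (1 : ℝ) • H1.toL2 (H2.partial v 1))
      (H1.toL2 (H2.partial v' 1)) = 0 := green_formula hD hb hR0 hR rfl h0 hv' 1
  have g4 : inner ℝ (H1.partial (H2.partial u 1) 0 + (-1 : ℝ) • H1.partial (H2.partial v 0) 0)
      (H2.toL2 v') + inner ℝ (H1.toL2 (H2.partial u 1) + (-1 : ℝ) • H1.toL2 (H2.partial v 0))
      (H1.toL2 (H2.partial v' 0)) = 0 := green_formula hD hb hR0 hR rfl h1 hv' 0
  -- The mixed derivatives of `v` cancel in the divergence and those of `u` in the curl, leaving the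
  -- two Laplacians.
  rw [H2.partial_partial_comm hΩ v 1 0] at g1
  rw [H2.partial_partial_comm hΩ u 0 1] at g3
  simp only [H2.laplacian, Fin.sum_univ_two]
  simp only [inner_add_left, inner_add_right, inner_smul_left, inner_smul_right, conj_trivial]
    at g1 g2 g3 g4 ⊢
  linear_combination g1 + g2 + g3 - g4

theorem IsCoupledSolution.eq_zero {D : Set Plane} (hD : HasSmoothBoundary D)
    (hb : Bornology.IsBounded D) {R T c₁ c₂ : ℝ} (hR0 : 0 < R) (hT : 0 < T)
    (hR : closure D ⊆ Metric.ball 0 R) (hc₁ : 0 < c₁) (hc₂ : 0 < c₂)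
    {φ ψ : L2Time T (H2 (annularDomain D R))} (h : IsCoupledSolution D R T c₁ c₂ 0 0 φ ψ) :
    φ = 0 ∧ ψ = 0 := by
  have hΩ : IsOpen (annularDomain D R) := Metric.isOpen_ball.sdiff isClosed_closure
  obtain ⟨⟨φ₁, φ₂, a1, a2, a3, a4, a5⟩, ⟨ψ₁, ψ₂, b1, b2, b3, b4, b5⟩, hcp, hout⟩ := h
  have hgood : ∀ᵐ t ∂volume.restrict (Ioo 0 T),
      (HasTrace (annularDomain D R) (frontier D)
        (H2.partial (φ t) 0 + (1 : ℝ) • H2.partial (ψ t) 1) 0 ∧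
      HasTrace (annularDomain D R) (frontier D)
        (H2.partial (φ t) 1 + (-1 : ℝ) • H2.partial (ψ t) 0) 0) := by
    filter_upwards [hcp] with t ⟨G, H, hG, hH, hx⟩ using hasTrace_displacement hD hG hH hx
  have iU : ∀ (i j : Fin 2) (c : ℝ), IntegrableOn (fun t => H1.toL2 (H2.partial (φ t) i) +
      c • H1.toL2 (H2.partial (ψ t) j)) (Ioo 0 T) := fun i j c =>
    (L2Time.integrableOn_component φ (.inr (.inl i))).add
      (Integrable.smul c (L2Time.integrableOn_component ψ (.inr (.inl j))))
  have hzero := ae_eq_zero_of_energy (k := 1 / c₁ ^ 2) (l := 1 / c₂ ^ 2) (by positivity)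
    (by positivity) φ₁.integrableOn φ₂.integrableOn ψ₁.integrableOn ψ₂.integrableOn
    (iU 0 1 1) (iU 1 0 (-1))
    (eq_primitive_of_hasWeakTimeDeriv hT φ₁.integrableOn a1 a4)
    (eq_primitive_of_hasWeakTimeDeriv hT φ₂.integrableOn a2 a5)
    (eq_primitive_of_hasWeakTimeDeriv hT ψ₁.integrableOn b1 b4)
    (eq_primitive_of_hasWeakTimeDeriv hT ψ₂.integrableOn b2 b5) (by
      -- Time t supplies the zero traces on the circle; time s supplies the zero displacement on ∂D
      -- and the wave equations.
      filter_upwards [hout] with t ht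
      filter_upwards [hgood, a3, b3] with s hs ea eb
      have := inner_laplacian_add_inner_laplacian hD hb hR0 hR hs.1 hs.2 ht.1 ht.2
      rw [sub_eq_zero.1 ea, sub_eq_zero.1 eb, real_inner_smul_left, real_inner_smul_left] at this
      exact this)
  have key : ∀ u : L2Time T (H2 (annularDomain D R)),
      (∀ᵐ t ∂volume.restrict (Ioo 0 T), H2.toL2 (u t) = 0) → u = 0 := fun u hu => by
    refine Lp.ext ?_
    filter_upwards [hu, Lp.coeFn_zero (H2 (annularDomain D R)) 2 (volume.restrict (Ioo 0 T))]
      with t ht h0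
    rw [h0, Pi.zero_apply, H2.eq_zero_of_toL2_eq_zero hΩ ht]
  exact ⟨key φ (hzero.mono fun t ht => ht.1), key ψ (hzero.mono fun t ht => ht.2)⟩

end

theorem theorem1 (D : Set Plane) (hDopen : IsOpen D) (hDconn : IsConnected D)
    (hDbdd : Bornology.IsBounded D) (hDsmooth : HasSmoothBoundary D)
    (lam mu : ℝ) (hmu : 0 < mu) (hlam : 0 < lam + mu)
    (T : ℝ) (hT : 0 < T) (R : ℝ) (hR : closure D ⊆ Metric.ball 0 R)
    (f₁ f₂ : ℝ → Plane → ℝ)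
    (φ ψ φ' ψ' : L2Time T (H2 (annularDomain D R)))
    (h : IsCoupledSolution D R T (Real.sqrt (lam + 2 * mu)) (Real.sqrt mu) f₁ f₂ φ ψ)
    (h' : IsCoupledSolution D R T (Real.sqrt (lam + 2 * mu)) (Real.sqrt mu) f₁ f₂ φ' ψ') :
    φ = φ' ∧ ψ = ψ' := by
  have hR0 : 0 < R := by
    obtain ⟨x, hx⟩ := hDconn.nonempty
    exact Metric.pos_of_mem_ball (hR (subset_closure hx))
  have hz := (h.sub h').eq_zero hDsmooth hDbdd hR0 hT hR (Real.sqrt_pos.2 (by linarith))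
    (Real.sqrt_pos.2 hmu)
  exact ⟨sub_eq_zero.1 hz.1, sub_eq_zero.1 hz.2⟩
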